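/- **Notation.** Let $X_0=[0,1]^2$ with the Euclidean metric. Let $X_1$ be the square complex obtained by subdividing $X_0$ into nine congruent subsquares and gluing to the middle one a second copy of it along its boundary; let $\pi\colon X_1\to X_0$ identify the two copies, and let $S\colon X_1\to X_0$ scale each of the ten subsquares by the factor $3$, with reflections so that $S$ is continuous. Let $X_n=\{(x_1,\dots,x_n): x_i\in X_1,\ \pi(x_{i+1})=S(x_i)\}$, a complex made of $10^n$ squares of side $3^{-n}$, with its path metric $d_n$. The *pillow space* is $$X=\{(x_i)_{i\ge 1}: x_i\in X_1,\ \pi(x_{i+1})=S(x_i)\},\qquad d_0(x,y)=\lim_{n\to\infty} d_n\big((x_1,\dots,x_n),(y_1,\dots,y_n)\big),$$ and $\Pi\colon X\to[0,1]^2$ is $\Pi(x)=\pi(x_1)$. Let $\iota_0=\mathrm{id}$, let $\iota_1\colon X_1\to X_1$ exchange the two middle squares, and let $s_0,s_1\colon X_0\to X_1$ be the two sections of $\pi$ given by the choice of one of the middle squares. For $w\in\{0,1\}^{\mathbb N}$ let $\iota_w(x)=(\iota_{w_i}(x_i))_i$, and let $s_w\colon[0,1]^2\to X$ be the map with $s_w(a)_1=s_{w_1}(a)$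 and $s_w(a)_{i+1}=s_{w_{i+1}}(S(s_w(a)_i))$. The *sheets* of $X$ are the images of the maps $s_w$. A metric $d$ on $X$ is *symmetric* if every $\iota_w$ is an isometry of $d$. A homeomorphism $f\colon (Z,d_Z)\to(W,d_W)$ is a *quasisymmetry* if there is a homeomorphism $\eta$ of $[0,\infty)$ with $\frac{d_W(f(x),f(y))}{d_W(f(x),f(z))}\le\eta\big(\frac{d_Z(x,y)}{d_Z(x,z)}\big)$ for all $x,y,z\in Z$, $x\ne z$. A map $f\colon Z\to W$ is a *Lipschitz quotient map* if for some $L>0$ one has $B(f(x),L^{-1}r)\subseteq f(B(x,r))\subseteq B(f(x),Lr)$ for all $x\in Z$, $r>0$. A complete metric space $Z$ with a Radon measure $\mu$ is a *$p$-PI space*, $1\le p<\infty$, if all balls have positive finite measure, $\mu$ is doubling, and there is $C>0$ such that $$\frac1{\mu(B)}\int_B|u-u_B|\,d\mu\le C\,\mathrm{diam}(B)\Big(\frac1{\mu(CB)}\int_{CB}\mathrm{Lip}[u]^p\,d\mu\Big)^{1/p}$$ for all balls $B$ and all compactly supported Lipschitz $u\colon Z\to\mathbb R$, where $u_B=\frac1{\mu(B)}\int_B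 u\,d\mu$ and $\mathrm{Lip}[u](x)=\limsup_{r\to0}\sup_{y\in B(x,r)}|u(y)-u(x)|/r$. A *PI space* is a $p$-PI space for some $p\in[1,\infty)$. For $Q>1$, a *$Q$-Loewner* space is a complete Ahlfors $Q$-regular space (there is $C>0$ with $C^{-1}r^Q\le\mathcal H^Q(B(x,r))\le Cr^Q$ for all $x$ and $0<r\le2\,\mathrm{diam}$) that is a $Q$-PI space with the measure $\mathcal H^Q$; by a theorem of Heinonen and Koskela this is equivalent to the definition by moduli of curve families. **Statement.** Let $Q>1$ and let $d_{SL}$ be a symmetric metric on the pillow space $X$ such that $(X,d_{SL})$ is $Q$-Loewner and the identity map $(X,d_0)\to(X,d_{SL})$ is a quasisymmetry. Then: 1. There is a metric $\rho$ on $[0,1]^2$ such that the identity map $([0,1]^2,|\cdot|)\to([0,1]^2,\rho)$ is a quasisymmetry, $\Pi\colon(X,d_{SL})\to([0,1]^2,\rho)$ is a Lipschitz quotient map, for every sheet $S$ the restriction $\Pi|_S$ is an isometry from $(S,d_{SL})$ onto $([0,1]^2,\rho)$ (which determines $\rho$), and $([0,1]^2,\rho,\Pi_*(\mathcal H^Q))$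 is a PI space, where $\mathcal H^Q$ is the Hausdorff measure of $(X,d_{SL})$. 2. For every sheet $S$ of $X$ there is a measure $\nu$ on $S$ such that $(S,d_{SL},\nu)$ is a PI space. -/

import Mathlib

open MeasureTheory Filter Topology Set
open scoped NNReal ENNReal

noncomputable section

namespace PillowSpace

/-! ### The unit square and the first stage of the construction -/

/-- The unit square `[0,1]²` with the Euclidean metric. -/
abbrev Square : Type := {a : EuclideanSpace ℝ (Fin 2) // ∀ i, a i ∈ Icc (0 : ℝ) 1}

/-- The folding map of `[0,1]`: it equals `3t` on `[0,1/3]`, `2 - 3t` on `[1/3,2/3]` and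
`3t - 2` on `[2/3,1]`, i.e. each third is scaled by `3` and reflected where continuity needs it. -/
def foldMap (t : ℝ) : ℝ := |1 - abs (3 * t - 1)|

theorem fold_mem {t : ℝ} (ht : t ∈ Icc (0 : ℝ) 1) : foldMap t ∈ Icc (0 : ℝ) 1 := by
  obtain ⟨h0, h1⟩ := ht
  refine ⟨abs_nonneg _, abs_le.2 ⟨?_, ?_⟩⟩
  · have : |3 * t - 1| ≤ 2 := abs_le.2 ⟨by linarith, by linarith⟩
    linarith
  · have := abs_nonneg (3 * t - 1)
    linarith

/-- Folding both coordinates of a point of the square. -/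
def foldSq (a : Square) : Square :=
  ⟨WithLp.toLp 2 fun i => foldMap (a.1 i), fun i => fold_mem (a.2 i)⟩

/-- The open middle square `(1/3,2/3)²`. -/
def openMiddle : Set Square := {a | ∀ i, a.1 i ∈ Ioo (1 / 3 : ℝ) (2 / 3)}

/-- Two copies (layers) of the square are glued along the complement of the open middle square. -/
def gluing : Setoid (Square × ZMod 2) where
  r p q := p.1 = q.1 ∧ (p.2 = q.2 ∨ p.1 ∉ openMiddle)
  iseqv := by
    refine ⟨fun p => ⟨rfl, Or.inl rfl⟩, ?_, ?_⟩
    · rintro p q ⟨h, h' | h'⟩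
      · exact ⟨h.symm, Or.inl h'.symm⟩
      · exact ⟨h.symm, Or.inr (h ▸ h')⟩
    · rintro p q r ⟨h1, h1'⟩ ⟨h2, h2'⟩
      refine ⟨h1.trans h2, ?_⟩
      rcases h1' with h1' | h1'
      · rcases h2' with h2' | h2'
        · exact Or.inl (h1'.trans h2')
        · exact Or.inr (h1 ▸ h2')
      · exact Or.inr h1'

/-- The complex `X₁`: the square, subdivided into nine subsquares, with its middle square doubled
along the boundary. -/
def X1 : Type := Quotient gluing

/-- The point of `X₁` over `a` in the layer `e`. For fixed `e` this is the lift `s_e` of the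
square to `X₁`. -/
def layerPt (e : ZMod 2) (a : Square) : X1 := Quotient.mk gluing (a, e)

/-- `π : X₁ → X₀` identifies the two copies of the middle square. -/
def piMap : X1 → Square := Quotient.lift (fun p : Square × ZMod 2 => p.1) fun _ _ h => h.1

/-- `S : X₁ → X₀` scales every subsquare by `3`, with reflections. -/
def sMap (x : X1) : Square := foldSq (piMap x)

/-- `ι_e : X₁ → X₁`; `ι_0` is the identity and `ι_1` exchanges the two middle squares. -/
def flipX1 (e : ZMod 2) : X1 → X1 :=
  Quotient.map (fun p : Square × ZMod 2 => (p.1, p.2 + e)) fun _ _ h =>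
    ⟨h.1, h.2.imp (fun h' => congrArg (· + e) h') id⟩

/-- The `j`-th closed third of the unit interval, `j = 0, 1, 2`. -/
def third (j : Fin 3) : Set ℝ := Icc (((j : ℕ) : ℝ) / 3) ((((j : ℕ) : ℝ) + 1) / 3)

/-- The cubes of `X₁`: the image of the `(j₀,j₁)`-th closed subsquare in the layer `e`.
The two layers give the same cube, except for the middle square `(1,1)`; so there are ten cubes. -/
def cube (c : (Fin 2 → Fin 3) × ZMod 2) : Set X1 :=
  {x | ∃ a : Square, (∀ i, a.1 i ∈ third (c.1 i)) ∧ x = layerPt c.2 a}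

/-! ### The finite stages and their metrics -/

/-- `Stage n` is the replacement complex `X_{n+1}`, the set of all `(x_0, …, x_n)` with entries in
`X₁` and `π(x_{i+1}) = S(x_i)`. -/
def Stage (n : ℕ) : Type :=
  {x : Fin (n + 1) → X1 // ∀ i : Fin n, piMap (x i.succ) = sMap (x i.castSucc)}

/-- The projection of a stage to the square `X₀`. -/
def stageProj {n : ℕ} (x : Stage n) : Square := piMap (x.1 0)

/-- Two points of a stage lie in a common cube. The cubes of `X_{n+1}` are given by words
`(c_0, …, c_n)` of cubes of `X₁` and consist of the points with `x_i ∈ c_i` for all `i`. -/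
def Linked {n : ℕ} (x y : Stage n) : Prop :=
  ∃ c : Fin (n + 1) → (Fin 2 → Fin 3) × ZMod 2, ∀ i, x.1 i ∈ cube (c i) ∧ y.1 i ∈ cube (c i)

/-- `ChainLength x y l`: there is an admissible chain of length `l` from `x` to `y`. Consecutive
points of the chain lie in a common cube, and a step is measured in the Euclidean metric of that
cube; as the projection to `X₀` is an isometry on each cube, this is the distance of the
projections. -/
inductive ChainLength {n : ℕ} (x : Stage n) : Stage n → ℝ → Prop
  | refl : ChainLength x x 0
  | step {y z : Stage n} {l : ℝ} : ChainLength x y l → Linked y z →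
      ChainLength x z (l + dist (stageProj y) (stageProj z))

/-- The path metric of the cubical complex `X_{n+1}`: the infimum of the lengths of chains. -/
def stageDist {n : ℕ} (x y : Stage n) : ℝ := sInf {l | ChainLength x y l}

/-! ### The pillow space -/

/-- The (set underlying the) pillow space: all sequences in `X₁` with `π(x_{i+1}) = S(x_i)`. -/
def Pillow : Type := {x : ℕ → X1 // ∀ i, piMap (x (i + 1)) = sMap (x i)}

/-- The map `π_{∞,n+1}` of the pillow space to `X_{n+1}`. -/
def trunc (n : ℕ) (x : Pillow) : Stage n := ⟨fun i => x.1 i, fun i => by simpa using x.2 i⟩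

/-- The projection `Π` of the pillow space to the square. -/
def proj (x : Pillow) : Square := piMap (x.1 0)

theorem piMap_lift (e : ZMod 2) (a : Square) : piMap (layerPt e a) = a := rfl

theorem piMap_flipX1 (e : ZMod 2) (x : X1) : piMap (flipX1 e x) = piMap x := by
  induction x using Quotient.inductionOn with
  | h p => rfl

/-- The map `s_w` of the square to the pillow space, for an infinite word `w`. -/
def sheetMap (w : ℕ → ZMod 2) (a : Square) : Pillow :=
  ⟨fun i => layerPt (w i) (foldSq^[i] a), fun i => by
    simp [sMap, piMap_lift, Function.iterate_succ_apply']⟩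

/-- The sheets of the pillow space. -/
def sheet (w : ℕ → ZMod 2) : Set Pillow := range (sheetMap w)

/-- The symmetry `ι_w` of the pillow space, for an infinite word `w`. -/
def symmetry (w : ℕ → ZMod 2) (x : Pillow) : Pillow :=
  ⟨fun i => flipX1 (w i) (x.1 i), fun i => by simp [sMap, piMap_flipX1, x.2 i]⟩

/-- The metric of the pillow space as a function, see `tendsto_stageDist`. -/
def pillowDist (x y : Pillow) : ℝ := ⨆ n, stageDist (trunc n x) (trunc n y)

/-! Facts needed to see that `pillowDist` is a metric. -/

theorem Linked.symm {n : ℕ} {x y : Stage n} (h : Linked x y) : Linked y x := by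
  obtain ⟨c, hc⟩ := h
  exact ⟨c, fun i => ⟨(hc i).2, (hc i).1⟩⟩

theorem ChainLength.trans {n : ℕ} {x y z : Stage n} {l m : ℝ} (h : ChainLength x y l)
    (h' : ChainLength y z m) : ChainLength x z (l + m) := by
  induction h' with
  | refl => simpa using h
  | step _ hl ih => rw [← add_assoc]; exact ih.step hl

theorem ChainLength.single {n : ℕ} {x y : Stage n} (h : Linked x y) :
    ChainLength x y (dist (stageProj x) (stageProj y)) := by
  simpa using ChainLength.refl.step h

theorem ChainLength.symm {n : ℕ} {x y : Stage n} {l : ℝ} (h : ChainLength x y l) :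
    ChainLength y x l := by
  induction h with
  | refl => exact .refl
  | step _ hl ih =>
    rw [add_comm, dist_comm]
    exact (ChainLength.single hl.symm).trans ih

theorem ChainLength.dist_le {n : ℕ} {x y : Stage n} {l : ℝ} (h : ChainLength x y l) :
    dist (stageProj x) (stageProj y) ≤ l := by
  induction h with
  | refl => simp
  | step _ _ ih => exact (dist_triangle _ _ _).trans (by gcongr)

theorem ChainLength.nonneg {n : ℕ} {x y : Stage n} {l : ℝ} (h : ChainLength x y l) : 0 ≤ l :=
  dist_nonneg.trans h.dist_le

theorem bddBelow_chain {n : ℕ} (x y : Stage n) : BddBelow {l | ChainLength x y l} :=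
  ⟨0, fun _ h => ChainLength.nonneg h⟩

theorem stageDist_le {n : ℕ} {x y : Stage n} {l : ℝ} (h : ChainLength x y l) :
    stageDist x y ≤ l := csInf_le (bddBelow_chain x y) h

theorem stageDist_comm {n : ℕ} (x y : Stage n) : stageDist x y = stageDist y x := by
  unfold stageDist
  congr 1
  ext l
  exact ⟨ChainLength.symm, ChainLength.symm⟩

theorem continuous_foldSq : Continuous foldSq := by
  unfold foldSq foldMap
  refine Continuous.subtype_mk ?_ _
  refine (PiLp.continuous_toLp 2 _).comp (continuous_pi fun i => ?_)
  have : Continuous fun a : Square => a.1 i := by fun_prop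
  fun_prop

/-- Points of `[0,1]` that are close to `t` lie in a common closed third with `t`. -/
theorem third_local (t : ℝ) (ht : t ∈ Icc (0 : ℝ) 1) :
    ∀ᶠ u in 𝓝 t, u ∈ Icc (0 : ℝ) 1 → ∃ j : Fin 3, t ∈ third j ∧ u ∈ third j := by
  obtain ⟨h0, h1⟩ := ht
  have key : ∀ a b : ℝ, ∀ j : Fin 3, a < b → (((j : ℕ) : ℝ) / 3) = a →
      ((((j : ℕ) : ℝ) + 1) / 3) = b → a ≤ t → t ≤ b → ∀ u, a ≤ u → u ≤ b →
      ∃ j : Fin 3, t ∈ third j ∧ u ∈ third j := by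
    intro a b j _ ha hb h1 h2 u h3 h4
    exact ⟨j, by simp only [third, ha, hb]; exact ⟨h1, h2⟩,
      by simp only [third, ha, hb]; exact ⟨h3, h4⟩⟩
  have k0 := key 0 (1 / 3) 0 (by norm_num) (by norm_num) (by norm_num)
  have k1 := key (1 / 3) (2 / 3) 1 (by norm_num) (by norm_num) (by norm_num)
  have k2 := key (2 / 3) 1 2 (by norm_num) (by norm_num) (by norm_num)
  rcases lt_trichotomy t (1 / 3) with h | h | h
  · filter_upwards [eventually_lt_nhds h] with u hu hu'
    exact k0 h0 h.le u hu'.1 hu.le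
  · filter_upwards [eventually_lt_nhds (show t < 2 / 3 by linarith)] with u hu hu'
    rcases le_total u (1 / 3) with h' | h'
    · exact k0 h0 h.le u hu'.1 h'
    · exact k1 h.ge (by linarith) u h' hu.le
  · rcases lt_trichotomy t (2 / 3) with g | g | g
    · filter_upwards [eventually_lt_nhds g, eventually_gt_nhds h] with u hu hv _
      exact k1 h.le g.le u hv.le hu.le
    · filter_upwards [eventually_gt_nhds h] with u hv hu'
      rcases le_total u (2 / 3) with h' | h'
      · exact k1 h.le g.le u hv.le h'
      · exact k2 g.ge h1 u h' hu'.2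
    · filter_upwards [eventually_gt_nhds g] with u hv hu'
      exact k2 g.le h1 u hv.le hu'.2

theorem linked_local (n : ℕ) (w : ℕ → ZMod 2) (a : Square) :
    ∀ᶠ b in 𝓝 a, Linked (trunc n (sheetMap w a)) (trunc n (sheetMap w b)) := by
  have h : ∀ k : Fin (n + 1), ∀ i : Fin 2, ∀ᶠ b in 𝓝 a, ∃ j : Fin 3,
      (foldSq^[k] a).1 i ∈ third j ∧ (foldSq^[k] b).1 i ∈ third j := by
    intro k i
    have hc : Continuous fun b : Square => (foldSq^[k] b).1 i := by
      have h1 := continuous_foldSq.iterate k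
      have h2 : Continuous fun b : Square => b.1 i := by fun_prop
      exact h2.comp h1
    filter_upwards [hc.continuousAt.eventually (third_local _ ((foldSq^[k] a).2 i))] with b hb
    exact hb ((foldSq^[k] b).2 i)
  simp only [← eventually_all] at h
  filter_upwards [h] with b hb
  choose j hj using hb
  exact ⟨fun k => (j k, w k), fun k =>
    ⟨⟨_, fun i => (hj k i).1, rfl⟩, ⟨_, fun i => (hj k i).2, rfl⟩⟩⟩

theorem stageProj_trunc (n : ℕ) (x : Pillow) : stageProj (trunc n x) = proj x := rfl

theorem proj_sheetMap (w : ℕ → ZMod 2) (a : Square) : proj (sheetMap w a) = a := rfl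

/-- On each sheet straight segments are limits of admissible chains. -/
theorem chain_sheet (n : ℕ) (w : ℕ → ZMod 2) (a b : Square) :
    ChainLength (trunc n (sheetMap w a)) (trunc n (sheetMap w b)) (dist a b) := by
  set γ : Icc (0 : ℝ) 1 → Square := fun t =>
    ⟨AffineMap.lineMap a.1 b.1 (t : ℝ), fun i => by
      have h1 := a.2 i
      have h2 := b.2 i
      have ht := t.2
      have h : (AffineMap.lineMap a.1 b.1 (t : ℝ) : EuclideanSpace ℝ (Fin 2)) i
          = (1 - (t : ℝ)) * a.1 i + t * b.1 i := by
        simp [AffineMap.lineMap_apply]; ring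
      rw [h]
      exact (convex_Icc (0 : ℝ) 1) h1 h2 (by linarith [ht.2]) ht.1 (by ring)⟩ with hγ
  have hγc : Continuous γ := by
    refine Continuous.subtype_mk ?_ _
    exact AffineMap.lineMap_continuous.comp continuous_subtype_val
  have hd : ∀ s t, dist (γ s) (γ t) = |(s : ℝ) - t| * dist a b := by
    intro s t
    rw [Subtype.dist_eq, dist_lineMap_lineMap, Real.dist_eq, ← Subtype.dist_eq]
  let C : Set (Icc (0 : ℝ) 1) := {t | ChainLength (trunc n (sheetMap w a))
    (trunc n (sheetMap w (γ t))) ((t : ℝ) * dist a b)}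
  have step : ∀ s t : Icc (0 : ℝ) 1, s ≤ t → s ∈ C →
      Linked (trunc n (sheetMap w (γ s))) (trunc n (sheetMap w (γ t))) → t ∈ C := by
    intro s t hst hs hl
    have := ChainLength.step hs hl
    rw [stageProj_trunc, stageProj_trunc, proj_sheetMap, proj_sheetMap, hd,
      abs_of_nonpos (sub_nonpos.2 (by exact_mod_cast hst))] at this
    have e : (s : ℝ) * dist a b + -((s : ℝ) - t) * dist a b = t * dist a b := by ring
    rwa [e] at this
  have hloc : ∀ t, ∀ᶠ s in 𝓝 t,
      Linked (trunc n (sheetMap w (γ t))) (trunc n (sheetMap w (γ s))) := fun t =>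
    hγc.continuousAt.eventually (linked_local n w (γ t))
  have h0 : (0 : Icc (0 : ℝ) 1) ∈ C := by
    have e : γ 0 = a := by ext1; simp [hγ]
    change ChainLength _ _ _
    rw [e]
    simpa using ChainLength.refl
  by_contra hcon
  have h1 : (1 : Icc (0 : ℝ) 1) ∉ C := by
    intro h
    have e : γ 1 = b := by ext1; simp [hγ]
    change ChainLength _ _ _ at h
    rw [e] at h
    exact hcon (by simpa using h)
  -- the supremum of the initial part of the segment that can be reached
  let D : Set (Icc (0 : ℝ) 1) := C
  have hDne : D.Nonempty := ⟨0, h0⟩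
  set m := sSup D with hm
  have hmC : m ∈ C := by
    have hlub : IsLUB D m := isLUB_sSup D
    have hfr : ∃ᶠ s in 𝓝[≤] m, s ∈ D := hlub.frequently_mem hDne
    have hev : ∀ᶠ s in 𝓝[≤] m, s ≤ m ∧
        Linked (trunc n (sheetMap w (γ m))) (trunc n (sheetMap w (γ s))) :=
      eventually_mem_nhdsWithin.and ((hloc m).filter_mono nhdsWithin_le_nhds)
    obtain ⟨s, hs, hsm, hl⟩ := (hfr.and_eventually hev).exists
    exact step s m hsm hs hl.symm
  have hm1 : m < 1 := lt_of_le_of_ne m.2.2 fun h => h1 (h ▸ hmC)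
  have hne : (𝓝[>] m).NeBot := nhdsGT_neBot_of_exists_gt ⟨1, hm1⟩
  have hev : ∀ᶠ s in 𝓝[>] m, m < s ∧
      Linked (trunc n (sheetMap w (γ m))) (trunc n (sheetMap w (γ s))) :=
    eventually_mem_nhdsWithin.and ((hloc m).filter_mono nhdsWithin_le_nhds)
  obtain ⟨s, hs, hl⟩ := hev.exists
  exact absurd (le_sSup (step m s hs.le hmC hl) : s ≤ m) (not_le.2 hs)

theorem iterate_eq (x : Pillow) (k : ℕ) : piMap (x.1 k) = foldSq^[k] (proj x) := by
  induction k with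
  | zero => rfl
  | succ k ih => rw [x.2 k, sMap, ih, Function.iterate_succ_apply']

theorem stage_iterate_eq {n : ℕ} (x : Stage n) (k : ℕ) (hk : k < n + 1) :
    piMap (x.1 ⟨k, hk⟩) = foldSq^[k] (stageProj x) := by
  induction k with
  | zero => rfl
  | succ k ih =>
    have := x.2 ⟨k, by omega⟩
    rw [Function.iterate_succ_apply', ← ih (by omega)]
    exact this

theorem exists_lift (x : X1) : ∃ e, x = layerPt e (piMap x) := by
  induction x using Quotient.inductionOn with
  | h p => exact ⟨p.2, rfl⟩

/-- Every point lies on a sheet. -/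
theorem exists_sheet (x : Pillow) : ∃ w, sheetMap w (proj x) = x := by
  choose w hw using fun k => exists_lift (x.1 k)
  refine ⟨w, Subtype.ext (funext fun k => ?_)⟩
  rw [hw k, iterate_eq]
  rfl

theorem lift_eq_iff {e e' : ZMod 2} {a a' : Square} :
    layerPt e a = layerPt e' a' ↔ a = a' ∧ (e = e' ∨ a ∉ openMiddle) :=
  Quotient.eq (r := gluing)

/-- All sheets meet at the corner `(0,0)`. -/
theorem sheetMap_corner (w w' : ℕ → ZMod 2) :
    sheetMap w ⟨0, by simp⟩ = sheetMap w' ⟨0, by simp⟩ := by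
  have hfix : ∀ k : ℕ, foldSq^[k] ⟨0, by simp⟩ = ⟨0, by simp⟩ := by
    intro k
    apply Function.iterate_fixed
    ext i
    simp [foldSq, foldMap]
  refine Subtype.ext (funext fun k => ?_)
  simp only [sheetMap, hfix]
  refine lift_eq_iff.2 ⟨rfl, Or.inr fun h => ?_⟩
  have := (h 0).1
  norm_num at this

theorem exists_chain (x y : Pillow) :
    ∃ l, ∀ n, ChainLength (trunc n x) (trunc n y) l := by
  obtain ⟨w, hw⟩ := exists_sheet x
  obtain ⟨w', hw'⟩ := exists_sheet y
  refine ⟨dist (proj x) ⟨0, by simp⟩ + dist ⟨0, by simp⟩ (proj y), fun n => ?_⟩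
  have h1 := chain_sheet n w (proj x) ⟨0, by simp⟩
  have h2 := chain_sheet n w' ⟨0, by simp⟩ (proj y)
  rw [hw] at h1
  rw [hw', sheetMap_corner w' w] at h2
  exact h1.trans h2

theorem stageDist_triangle (n : ℕ) (x y z : Pillow) :
    stageDist (trunc n x) (trunc n z)
      ≤ stageDist (trunc n x) (trunc n y) + stageDist (trunc n y) (trunc n z) := by
  obtain ⟨l, hl⟩ := exists_chain x y
  obtain ⟨m, hm⟩ := exists_chain y z
  refine le_of_forall_pos_le_add fun ε hε => ?_
  obtain ⟨l', hl', hlt⟩ := exists_lt_of_csInf_lt ⟨l, hl n⟩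
    (lt_add_of_pos_right (stageDist (trunc n x) (trunc n y)) (half_pos hε))
  obtain ⟨m', hm', hmt⟩ := exists_lt_of_csInf_lt ⟨m, hm n⟩
    (lt_add_of_pos_right (stageDist (trunc n y) (trunc n z)) (half_pos hε))
  have := stageDist_le (ChainLength.trans hl' hm')
  linarith

theorem bddAbove_stageDist (x y : Pillow) :
    BddAbove (range fun n => stageDist (trunc n x) (trunc n y)) := by
  obtain ⟨l, hl⟩ := exists_chain x y
  exact ⟨l, by rintro _ ⟨n, rfl⟩; exact stageDist_le (hl n)⟩

theorem stageDist_mono (x y : Pillow) :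
    Monotone fun n => stageDist (trunc n x) (trunc n y) := by
  refine monotone_nat_of_le_succ fun n => ?_
  obtain ⟨l, hl⟩ := exists_chain x y
  refine csInf_le_csInf (bddBelow_chain _ _) ⟨l, hl (n + 1)⟩ fun m hm => ?_
  let R : Stage (n + 1) → Stage n := fun z => ⟨fun i => z.1 i.castSucc, fun i => z.2 i.castSucc⟩
  have hR : ∀ (u v : Stage (n + 1)) (m : ℝ), ChainLength u v m → ChainLength (R u) (R v) m := by
    intro u v m h
    induction h with
    | refl => exact .refl
    | step _ hl ih =>
      obtain ⟨c, hc⟩ := hl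
      exact ih.step ⟨fun i => c i.castSucc, fun i => hc i.castSucc⟩
  exact hR _ _ _ hm

/-- The metric of the pillow space is the limit of the metrics of the stages. -/
theorem tendsto_stageDist (x y : Pillow) :
    Tendsto (fun n => stageDist (trunc n x) (trunc n y)) atTop (𝓝 (pillowDist x y)) :=
  tendsto_atTop_ciSup (stageDist_mono x y) (bddAbove_stageDist x y)

theorem isOpen_openMiddle : IsOpen openMiddle := by
  have : openMiddle = ⋂ i : Fin 2, {a : Square | a.1 i ∈ Ioo (1 / 3 : ℝ) (2 / 3)} := by
    ext a; simp [openMiddle]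
  rw [this]
  refine isOpen_iInter_of_finite fun i => isOpen_Ioo.preimage ?_
  fun_prop

theorem eq_of_pillowDist_eq_zero {x y : Pillow} (h : pillowDist x y = 0) : x = y := by
  have hn : ∀ n, ∀ ε > 0, ∃ l < ε, ChainLength (trunc n x) (trunc n y) l := by
    intro n ε hε
    obtain ⟨l, hl⟩ := exists_chain x y
    have h1 : stageDist (trunc n x) (trunc n y) < ε :=
      lt_of_le_of_lt ((le_ciSup (bddAbove_stageDist x y) n).trans h.le) hε
    obtain ⟨l', hl', hlt⟩ := exists_lt_of_csInf_lt ⟨l, hl n⟩ h1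
    exact ⟨l', hlt, hl'⟩
  have hp : proj x = proj y := by
    refine eq_of_forall_dist_le fun ε hε => ?_
    obtain ⟨l, hl, hc⟩ := hn 0 ε hε
    exact hc.dist_le.trans hl.le
  refine Subtype.ext (funext fun k => ?_)
  obtain ⟨e, he⟩ := exists_lift (x.1 k)
  obtain ⟨e', he'⟩ := exists_lift (y.1 k)
  by_cases hmid : foldSq^[k] (proj x) ∈ openMiddle
  · have hopen := (isOpen_openMiddle.preimage (continuous_foldSq.iterate k)).mem_nhds hmid
    obtain ⟨ε, hε, hball⟩ := Metric.mem_nhds_iff.1 hopen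
    obtain ⟨l, hl, hc⟩ := hn k ε hε
    have key : ∀ (z : Stage k) (l : ℝ), ChainLength (trunc k x) z l → l < ε →
        z.1 (Fin.last k) = layerPt e (foldSq^[k] (stageProj z)) := by
      intro z l hz
      induction hz with
      | refl => intro _; rw [← stage_iterate_eq _ k (by omega)]; exact he
      | @step u v m hu hl ih =>
        intro hlt
        have hm : m < ε := lt_of_le_of_lt (le_add_of_nonneg_right dist_nonneg) hlt
        have hu' := ih hm
        have humid : foldSq^[k] (stageProj u) ∈ openMiddle := by
          refine hball ?_
          rw [Metric.mem_ball, dist_comm]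
          exact lt_of_le_of_lt hu.dist_le hm
        obtain ⟨c, hc⟩ := hl
        obtain ⟨⟨a, -, ha⟩, ⟨b, -, hb⟩⟩ := hc (Fin.last k)
        rw [hu', lift_eq_iff] at ha
        have he : e = (c (Fin.last k)).2 := ha.2.resolve_right (not_not.2 humid)
        have hb' : b = foldSq^[k] (stageProj v) := by
          rw [← stage_iterate_eq v k (by omega)]
          change b = piMap (v.1 (Fin.last k))
          rw [hb, piMap_lift]
        rw [hb, he, hb']
    have := key _ l hc hl
    change y.1 k = _ at this
    rw [he, iterate_eq, this, stageProj_trunc, hp]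
  · rw [he, he', iterate_eq, iterate_eq, ← hp]
    exact lift_eq_iff.2 ⟨rfl, Or.inr hmid⟩

theorem pillowDist_self (x : Pillow) : pillowDist x x = 0 := by
  have h : ∀ n, stageDist (trunc n x) (trunc n x) = 0 := fun n =>
    le_antisymm (stageDist_le .refl) (Real.sInf_nonneg fun _ h => ChainLength.nonneg h)
  simp [pillowDist, h]

theorem pillowDist_comm (x y : Pillow) : pillowDist x y = pillowDist y x := by
  simp only [pillowDist, fun n => stageDist_comm (trunc n x) (trunc n y)]

theorem pillowDist_triangle (x y z : Pillow) :
    pillowDist x z ≤ pillowDist x y + pillowDist y z :=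
  ciSup_le fun n => (stageDist_triangle n x y z).trans
    (add_le_add (le_ciSup (bddAbove_stageDist x y) n) (le_ciSup (bddAbove_stageDist y z) n))

/-- The geodesic metric `d₀` of the pillow space. -/
@[reducible] def pillowMetric : MetricSpace Pillow where
  dist := pillowDist
  dist_self := pillowDist_self
  dist_comm := pillowDist_comm
  dist_triangle := pillowDist_triangle
  eq_of_dist_eq_zero := eq_of_pillowDist_eq_zero

/-! ### Changing the metric of a space -/

/-- The set `X` with the metric `d` (and its Borel sets), whatever other metric `X` carries. -/
def WithMetric (X : Type) (_d : MetricSpace X) : Type := X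

instance (X : Type) (d : MetricSpace X) : MetricSpace (WithMetric X d) := d

instance (X : Type) (d : MetricSpace X) : MeasurableSpace (WithMetric X d) :=
  borel (WithMetric X d)

instance (X : Type) (d : MetricSpace X) : BorelSpace (WithMetric X d) := ⟨rfl⟩

/-- A point of `X` as a point of `X` with the metric `d`. -/
def toMetric {X : Type} (d : MetricSpace X) (x : X) : WithMetric X d := x

/-- A point of `X` with the metric `d` as a point of `X`. -/
def ofMetric {X : Type} (d : MetricSpace X) (x : WithMetric X d) : X := x

/-- The Euclidean metric of the square. -/
@[reducible] def squareMetric : MetricSpace Square := inferInstance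

/-- A metric on the pillow space is symmetric if all `ι_w` are isometries of it. -/
def IsSymmetricMetric (d : MetricSpace Pillow) : Prop :=
  ∀ (w : ℕ → ZMod 2) (x y : Pillow),
    dist (toMetric d (symmetry w x)) (toMetric d (symmetry w y)) = dist (toMetric d x) (toMetric d y)

/-! ### Quasisymmetries and Lipschitz quotients -/

/-- Quasisymmetric maps: homeomorphisms with a control function `η`, a homeomorphism of
`[0,∞)`. -/
def IsQuasisymmetry {X Y : Type} [MetricSpace X] [MetricSpace Y] (f : X → Y) : Prop :=
  IsHomeomorph f ∧ ∃ η : ℝ≥0 ≃ₜ ℝ≥0, ∀ x y z : X, x ≠ z →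
    nndist (f x) (f y) / nndist (f x) (f z) ≤ η (nndist x y / nndist x z)

/-- The identity map of `X` is a quasisymmetry from the metric `d₁` to the metric `d₂`. -/
def QuasisymmetricByIdentity {X : Type} (d₁ d₂ : MetricSpace X) : Prop :=
  IsQuasisymmetry fun x : WithMetric X d₁ => toMetric d₂ (ofMetric d₁ x)

/-- Lipschitz quotient maps. -/
def IsLipschitzQuotient {X Y : Type} [MetricSpace X] [MetricSpace Y] (f : X → Y) : Prop :=
  ∃ L : ℝ, 0 < L ∧ ∀ (x : X) (r : ℝ), 0 < r →
    Metric.ball (f x) (L⁻¹ * r) ⊆ f '' Metric.ball x r ∧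
    f '' Metric.ball x r ⊆ Metric.ball (f x) (L * r)

/-- The projection `Π` from the pillow space with the metric `d` to the square with the metric
`ρ`. -/
def projFrom (d : MetricSpace Pillow) (ρ : MetricSpace Square) (x : WithMetric Pillow d) :
    WithMetric Square ρ :=
  toMetric ρ (proj (ofMetric d x))

/-! ### PI spaces and Loewner spaces -/

/-- The pointwise Lipschitz constant
`Lip[u](x) = limsup_{r → 0} sup_{y ∈ B(x,r)} |u(y) - u(x)| / r`. -/
def pointLip {X : Type} [MetricSpace X] (u : X → ℝ) (x : X) : ℝ≥0∞ :=
  limsup (fun r : ℝ => ⨆ y ∈ Metric.ball x r, ENNReal.ofReal (|u y - u x| / r)) (𝓝[>] 0)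

/-- Doubling measures; balls have positive and finite measure. -/
def IsDoublingMeasure {X : Type} [MetricSpace X] [MeasurableSpace X] (μ : Measure X) : Prop :=
  ∃ C : ℝ≥0, ∀ (x : X) (r : ℝ), 0 < r →
    0 < μ (Metric.ball x r) ∧ μ (Metric.ball x r) < ∞ ∧
    μ (Metric.ball x (2 * r)) ≤ C * μ (Metric.ball x r)

/-- The `p`-Poincaré inequality for Lipschitz functions with compact support. -/
def PoincareInequality {X : Type} [MetricSpace X] [MeasurableSpace X] (p : ℝ)
    (μ : Measure X) : Prop :=
  ∃ C : ℝ, 0 < C ∧ ∀ u : X → ℝ, (∃ K : ℝ≥0, LipschitzWith K u) → HasCompactSupport u →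
    ∀ (x : X) (r : ℝ), 0 < r →
      ⨍⁻ y in Metric.ball x r, ENNReal.ofReal |u y - ⨍ z in Metric.ball x r, u z ∂μ| ∂μ ≤
        ENNReal.ofReal (C * Metric.diam (Metric.ball x r)) *
          (⨍⁻ y in Metric.ball x (C * r), pointLip u y ^ p ∂μ) ^ (1 / p)

/-- `p`-PI spaces: complete metric spaces with a Radon measure that is doubling and supports a
`p`-Poincaré inequality, `1 ≤ p < ∞`. -/
structure IsPPISpace {X : Type} [MetricSpace X] [MeasurableSpace X] [BorelSpace X] (p : ℝ)
    (μ : Measure X) : Prop where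
  one_le : 1 ≤ p
  complete : CompleteSpace X
  radon : μ.Regular
  doubling : IsDoublingMeasure μ
  poincare : PoincareInequality p μ

/-- PI spaces. -/
def IsPISpace {X : Type} [MetricSpace X] [MeasurableSpace X] [BorelSpace X]
    (μ : Measure X) : Prop :=
  ∃ p : ℝ, IsPPISpace p μ

/-- Ahlfors `Q`-regularity of `X`, with respect to the Hausdorff measure: the measure of `B(x,r)`
is comparable to `r^Q` for `0 < r ≤ 2 diam X`. -/
def IsAhlforsRegular (Q : ℝ) (X : Type) [MetricSpace X] [MeasurableSpace X] [BorelSpace X] :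
    Prop :=
  ∃ C : ℝ, 0 < C ∧ ∀ (x : X) (r : ℝ), 0 < r → ENNReal.ofReal r ≤ 2 * Metric.ediam (univ : Set X) →
    ENNReal.ofReal (C⁻¹ * r ^ Q) ≤ Measure.hausdorffMeasure Q (Metric.ball x r) ∧
    Measure.hausdorffMeasure Q (Metric.ball x r) ≤ ENNReal.ofReal (C * r ^ Q)

/-- `Q`-Loewner spaces, `Q > 1`: complete Ahlfors `Q`-regular spaces that are `Q`-PI spaces with
their Hausdorff measure. -/
structure IsLoewner (Q : ℝ) (X : Type) [MetricSpace X] [MeasurableSpace X] [BorelSpace X] :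
    Prop where
  one_lt : 1 < Q
  regular : IsAhlforsRegular Q X
  pi : IsPPISpace Q (Measure.hausdorffMeasure Q : Measure X)

end PillowSpace

end

open PillowSpace

/-!
For a symmetric metric `d` the distance `d(s_w(a), s_w(b))` does not depend on the word `w`, because
`ι_w` is an isometry with `ι_w ∘ s_v = s_{v+w}`. This defines the metric `ρ` on the square
(`sheetMetric`), for which all sheets are isometric to the square. The sheets are also isometric to
the Euclidean square in the geodesic metric `d₀`, so the quasisymmetry from `d₀` to `d` restricts to
one from the Euclidean metric to `ρ`. If `x` lies on the sheet of `w` and `z = s_w(Π(y))`, then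
`d₀(x,z) ≤ d₀(x,y)`, and quasisymmetry gives `ρ(Π(x),Π(y)) = d(x,z) ≤ L d(x,y)`; thus `Π` is
Lipschitz. Distances also lift exactly along sheets, and the `ι_w` act transitively on the fibres of
`Π` by isometries, which preserve the Hausdorff measure. These properties make up the notion
`IsSymmetricQuotient`, and everything else is a general fact about it: a nontrivial connected
symmetric quotient `f : X → Y` of a compact PI space is a PI space for the pushforward measure
(`IsSymmetricQuotient.isPISpace_map`). Besides the square, it applies to a sheet `w` with the map
`s_w ∘ Π`.

The proof of the general fact takes a maximal `r`-separated subset `F` of the fibre through `x`. The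
preimage of `B(f(x),r)` is covered by the balls `B(n,2r)`, `n ∈ F`, and the balls `B(n,r)` have
bounded overlap. By symmetry, a function that factors through `f` has the same integral over each of
the balls `B(n,s)`. Hence averages over balls of `Y` are comparable with averages of the lifted
function over single balls of `X` (`exists_setLAverage_map_le`, `exists_setLAverage_comp_le`), and
doubling and the Poincaré inequality descend to `Y`. The descended Poincaré inequality has one
constant in front and another for the dilation of the ball; a larger exponent makes them equal
(`exists_poincareInequality_of_two_constants`).
-/

namespace PillowSpace

/-! ### Doubling measures -/

section Doubling

variable {X : Type} [MetricSpace X] [MeasurableSpace X]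

theorem IsDoublingMeasure.exists_pow_bound {μ : Measure X} (hμ : IsDoublingMeasure μ) :
    ∃ D : ℝ≥0, 1 ≤ D ∧ ∀ (k : ℕ) (x : X) (r : ℝ), 0 < r →
      μ (Metric.ball x (2 ^ k * r)) ≤ (D : ℝ≥0∞) ^ k * μ (Metric.ball x r) := by
  obtain ⟨C, hC⟩ := hμ
  refine ⟨max C 1, le_max_right _ _, fun k x r hr => ?_⟩
  induction k with
  | zero => simp
  | succ k ih =>
    calc μ (Metric.ball x (2 ^ (k + 1) * r))
        = μ (Metric.ball x (2 * (2 ^ k * r))) := by rw [pow_succ']; ring_nf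
      _ ≤ C * μ (Metric.ball x (2 ^ k * r)) := (hC x _ (by positivity)).2.2
      _ ≤ (max C 1 : ℝ≥0) * ((max C 1 : ℝ≥0) ^ k * μ (Metric.ball x r)) := by
        gcongr
        exact le_max_left _ _
      _ = _ := by rw [← mul_assoc, ← pow_succ']

theorem IsDoublingMeasure.exists_bound {μ : Measure X} (hμ : IsDoublingMeasure μ) (Λ : ℝ) :
    ∃ K : ℝ≥0, ∀ (x : X) (r s : ℝ), 0 < r → s ≤ Λ * r →
      μ (Metric.ball x s) ≤ K * μ (Metric.ball x r) := by
  obtain ⟨D, -, hD⟩ := hμ.exists_pow_bound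
  obtain ⟨k, hk⟩ := pow_unbounded_of_one_lt Λ (one_lt_two (α := ℝ))
  refine ⟨D ^ k, fun x r s hr hs => ?_⟩
  refine (measure_mono (Metric.ball_subset_ball (hs.trans ?_))).trans
    ((hD k x r hr).trans_eq (by push_cast; rfl))
  gcongr

theorem IsDoublingMeasure.ball_pos {μ : Measure X} (hμ : IsDoublingMeasure μ) (x : X) {r : ℝ}
    (hr : 0 < r) : μ (Metric.ball x r) ≠ 0 := by
  obtain ⟨C, hC⟩ := hμ
  exact (hC x r hr).1.ne'

theorem IsDoublingMeasure.ball_ne_top {μ : Measure X} (hμ : IsDoublingMeasure μ) (x : X) (r : ℝ) :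
    μ (Metric.ball x r) ≠ ∞ := by
  obtain ⟨C, hC⟩ := hμ
  exact ((measure_mono (Metric.ball_subset_ball (le_max_left r 1))).trans_lt
    (hC x (max r 1) (by positivity)).2.1).ne

theorem IsDoublingMeasure.measure_univ_ne_top {μ : Measure X} (hμ : IsDoublingMeasure μ)
    (hb : Bornology.IsBounded (univ : Set X)) : μ univ ≠ ∞ := by
  rcases isEmpty_or_nonempty X with h | ⟨⟨x⟩⟩
  · simp [univ_eq_empty_iff.2 h]
  · obtain ⟨r, hr⟩ := hb.subset_ball x
    exact ((measure_mono hr).trans_lt (hμ.ball_ne_top x r).lt_top).ne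

end Doubling

/-! ### Separated sets -/

section Separated

variable {X : Type} [MetricSpace X]

theorem exists_maximal_separated (A : Set X) {r : ℝ} (hr : 0 < r) {N : ℕ}
    (hN : ∀ F : Finset X, (F : Set X).Pairwise (fun x y => r ≤ dist x y) → F.card ≤ N) :
    ∃ F : Finset X, (F : Set X) ⊆ A ∧ (F : Set X).Pairwise (fun x y => r ≤ dist x y) ∧
      ∀ x ∈ A, ∃ n ∈ F, dist x n < r := by
  classical
  by_contra! hcon
  have h : ∀ k : ℕ, ∃ F : Finset X, (F : Set X) ⊆ A ∧
      (F : Set X).Pairwise (fun x y => r ≤ dist x y) ∧ F.card = k := by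
    intro k
    induction k with
    | zero => exact ⟨∅, by simp, by simp, rfl⟩
    | succ k ih =>
      obtain ⟨F, hFA, hF, hk⟩ := ih
      obtain ⟨x, hxA, hx⟩ := hcon F hFA hF
      have hxF : x ∉ F := fun h => by
        have := hx x h
        rw [dist_self] at this
        linarith
      refine ⟨insert x F, ?_, ?_, by rw [Finset.card_insert_of_notMem hxF, hk]⟩
      · rw [Finset.coe_insert]
        exact insert_subset hxA hFA
      · rw [Finset.coe_insert]
        refine hF.insert fun y hy _ => ⟨hx y hy, ?_⟩
        rw [dist_comm]
        exact hx y hy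
  obtain ⟨F, -, hF, hc⟩ := h (N + 1)
  have := hN F hF
  omega

theorem pairwiseDisjoint_ball {F : Set X} {r s : ℝ}
    (hF : F.Pairwise fun x y => r ≤ dist x y) (hs : s ≤ r / 2) :
    F.PairwiseDisjoint fun x => Metric.ball x s := fun _ hx _ hy hxy =>
  Metric.ball_disjoint_ball (by linarith [hF hx hy hxy])

variable [MeasurableSpace X] [OpensMeasurableSpace X]

theorem sum_measure_ball_le (μ : Measure X) {F : Finset X} {r s : ℝ}
    (hF : (F : Set X).Pairwise fun x y => r ≤ dist x y) (hs : s ≤ r / 2) {U : Set X}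
    (hU : ∀ n ∈ F, Metric.ball n s ⊆ U) : ∑ n ∈ F, μ (Metric.ball n s) ≤ μ U := by
  rw [← measure_biUnion_finset (pairwiseDisjoint_ball hF hs) fun _ _ =>
    Metric.isOpen_ball.measurableSet]
  exact measure_mono (iUnion₂_subset hU)

/-- In a bounded space with a doubling measure the balls of a fixed radius have measure bounded
below, so disjoint ones are boundedly many. -/
theorem IsDoublingMeasure.exists_card_bound {μ : Measure X} (hμ : IsDoublingMeasure μ)
    (hb : Bornology.IsBounded (univ : Set X)) {r : ℝ} (hr : 0 < r) :
    ∃ N : ℕ, ∀ F : Finset X, (F : Set X).Pairwise (fun x y => r ≤ dist x y) → F.card ≤ N := by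
  rcases isEmpty_or_nonempty X with h | ⟨⟨x₀⟩⟩
  · exact ⟨0, fun F _ => by simp [Finset.eq_empty_of_isEmpty F]⟩
  obtain ⟨R, hR⟩ := Metric.isBounded_iff.1 hb
  obtain ⟨K, hK⟩ := hμ.exists_bound ((R + 1) / (r / 2))
  obtain ⟨N, hN⟩ := exists_nat_ge K
  have hfin := hμ.measure_univ_ne_top hb
  have hpos : μ univ ≠ 0 := fun h => hμ.ball_pos x₀ hr (measure_mono_null (subset_univ _) h)
  have hball : ∀ n : X, μ univ ≤ K * μ (Metric.ball n (r / 2)) := by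
    intro n
    refine (measure_mono ?_).trans (hK n (r / 2) (R + 1) (by positivity) ?_)
    · intro y _
      exact Metric.mem_ball.2 ((hR (mem_univ y) (mem_univ n)).trans_lt (lt_add_one R))
    · rw [div_mul_cancel₀ _ (by positivity)]
  refine ⟨N, fun F hF => ?_⟩
  have h1 : (F.card : ℝ≥0∞) * μ univ ≤ K * μ univ := by
    calc (F.card : ℝ≥0∞) * μ univ = ∑ n ∈ F, μ univ := by simp
      _ ≤ ∑ n ∈ F, K * μ (Metric.ball n (r / 2)) := Finset.sum_le_sum fun n _ => hball n
      _ = K * ∑ n ∈ F, μ (Metric.ball n (r / 2)) := by rw [Finset.mul_sum]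
      _ ≤ K * μ univ := by
        gcongr
        exact sum_measure_ball_le μ hF le_rfl fun _ _ => subset_univ _
  have h2 : (F.card : ℝ≥0∞) ≤ K := (ENNReal.mul_le_mul_iff_left hpos hfin).1 h1
  have h3 : (F.card : ℝ≥0) ≤ K := by exact_mod_cast h2
  exact_mod_cast h3.trans hN

theorem IsDoublingMeasure.compactSpace {μ : Measure X} (hμ : IsDoublingMeasure μ)
    (hb : Bornology.IsBounded (univ : Set X)) [CompleteSpace X] : CompactSpace X := by
  refine ⟨isCompact_iff_totallyBounded_isComplete.2 ⟨Metric.totallyBounded_iff.2 fun ε hε => ?_,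
    isComplete_univ⟩⟩
  obtain ⟨N, hN⟩ := hμ.exists_card_bound hb hε
  obtain ⟨F, -, -, hF⟩ := exists_maximal_separated univ hε hN
  refine ⟨F, F.finite_toSet, fun x hx => ?_⟩
  obtain ⟨n, hn, hxn⟩ := hF x hx
  exact mem_iUnion₂.2 ⟨n, hn, hxn⟩

end Separated

/-! ### The pointwise Lipschitz constant -/

section PointLip

variable {X : Type} [MetricSpace X]

theorem lowerSemicontinuous_iSup_ball {u : X → ℝ} (hu : Continuous u) (r : ℝ) :
    LowerSemicontinuous fun x => ⨆ y ∈ Metric.ball x r, ENNReal.ofReal (|u y - u x| / r) := by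
  intro x t ht
  obtain ⟨y, hy⟩ := lt_iSup_iff.1 ht
  obtain ⟨hyx, hy⟩ := lt_iSup_iff.1 hy
  have h1 : ∀ᶠ z in 𝓝 x, y ∈ Metric.ball z r := by
    have : Tendsto (fun z => dist y z) (𝓝 x) (𝓝 (dist y x)) :=
      (continuous_const.dist continuous_id).tendsto x
    exact this.eventually_lt_const hyx
  have h2 : ∀ᶠ z in 𝓝 x, t < ENNReal.ofReal (|u y - u z| / r) := by
    have : Continuous fun z => ENNReal.ofReal (|u y - u z| / r) :=
      ENNReal.continuous_ofReal.comp (by fun_prop)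
    exact (this.tendsto x).eventually_const_lt hy
  filter_upwards [h1, h2] with z hz1 hz2
  exact hz2.trans_le (le_iSup₂ (f := fun y (_ : y ∈ Metric.ball z r) =>
    ENNReal.ofReal (|u y - u z| / r)) y hz1)

theorem measurable_pointLip [MeasurableSpace X] [OpensMeasurableSpace X] {u : X → ℝ}
    (hu : Continuous u) : Measurable (pointLip u) := by
  have hb : (𝓝[>] (0 : ℝ)).HasBasis (fun _ : ℕ => True) fun n => Ioo (0 : ℝ) (1 / (n + 1)) := by
    refine (nhdsGT_basis (0 : ℝ)).to_hasBasis (fun a ha => ?_) fun n _ =>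
      ⟨1 / (n + 1), by positivity, subset_rfl⟩
    obtain ⟨n, hn⟩ := exists_nat_one_div_lt ha
    exact ⟨n, trivial, Ioo_subset_Ioo_right hn.le⟩
  have h : pointLip u = fun x => ⨅ n : ℕ, ⨆ r ∈ Ioo (0 : ℝ) (1 / (n + 1)),
      ⨆ y ∈ Metric.ball x r, ENNReal.ofReal (|u y - u x| / r) := by
    ext x
    rw [pointLip, hb.limsup_eq_iInf_iSup]
    simp
  rw [h]
  refine Measurable.iInf fun n => LowerSemicontinuous.measurable ?_
  exact lowerSemicontinuous_biSup fun r _ => lowerSemicontinuous_iSup_ball hu r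

theorem pointLip_comp_le {Y : Type} [MetricSpace Y] {f : X → Y} {L : ℝ≥0} (hL : L ≠ 0)
    (hf : LipschitzWith L f) (u : Y → ℝ) (x : X) :
    pointLip (u ∘ f) x ≤ L * pointLip u (f x) := by
  have hL' : (0 : ℝ) < L := by positivity
  have htend : Tendsto (fun r : ℝ => L * r) (𝓝[>] 0) (𝓝[>] 0) := by
    refine tendsto_nhdsWithin_iff.2 ⟨?_, ?_⟩
    · have : Tendsto (fun r : ℝ => L * r) (𝓝 0) (𝓝 (L * 0)) :=
        (continuous_const.mul continuous_id).tendsto 0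
      rw [mul_zero] at this
      exact this.mono_left nhdsWithin_le_nhds
    · filter_upwards [self_mem_nhdsWithin] with r hr
      exact mul_pos hL' hr
  let S : ℝ → ℝ≥0∞ := fun r => ⨆ z ∈ Metric.ball (f x) r, ENNReal.ofReal (|u z - u (f x)| / r)
  calc pointLip (u ∘ f) x
      ≤ limsup (fun r => L * S (L * r)) (𝓝[>] 0) := by
        refine limsup_le_limsup ?_
        filter_upwards [self_mem_nhdsWithin] with r hr
        rw [mem_Ioi] at hr
        refine iSup₂_le fun y hy => ?_
        have hfy : f y ∈ Metric.ball (f x) (L * r) :=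
          (hf.dist_le_mul y x).trans_lt (by gcongr; exact hy)
        have he : |u (f y) - u (f x)| / r = L * (|u (f y) - u (f x)| / (L * r)) := by
          field_simp
        simp only [Function.comp_apply]
        rw [he, ENNReal.ofReal_mul hL'.le, ENNReal.ofReal_coe_nnreal]
        gcongr
        exact le_iSup₂ (f := fun z (_ : z ∈ Metric.ball (f x) (L * r)) =>
          ENNReal.ofReal (|u z - u (f x)| / (L * r))) (f y) hfy
    _ = L * limsup (S ∘ fun r : ℝ => L * r) (𝓝[>] 0) :=
        ENNReal.limsup_const_mul_of_ne_top ENNReal.coe_ne_top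
    _ ≤ L * limsup S (𝓝[>] 0) := by
        gcongr
        rw [limsup_comp]
        exact limsup_le_limsup_of_le htend

end PointLip

/-! ### Averages -/

section Average

variable {α : Type} [MeasurableSpace α]

theorem ennreal_div_le_mul_div {A B h ν K : ℝ≥0∞} (hh : h ≠ 0) (hh' : h ≠ ∞) (hν : ν ≠ 0)
    (hν' : ν ≠ ∞) (H : A * ν ≤ K * (B * h)) : A / h ≤ K * (B / ν) := by
  rw [ENNReal.div_le_iff hh hh', ← mul_div_assoc, mul_comm, ← mul_div_assoc,
    ENNReal.le_div_iff_mul_le (Or.inl hν) (Or.inl hν')]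
  exact H.trans_eq (by ring)

/-- Replacing the average of `u` by any other constant changes the mean oscillation at most by a
factor of two. -/
theorem laverage_sub_average_le {μ : Measure α} [IsFiniteMeasure μ] {u : α → ℝ}
    (hu : Integrable u μ) (c : ℝ) :
    ⨍⁻ y, ENNReal.ofReal |u y - ⨍ z, u z ∂μ| ∂μ ≤ 2 * ⨍⁻ y, ENNReal.ofReal |u y - c| ∂μ := by
  rcases eq_or_ne μ 0 with h0 | h0
  · simp [h0]
  have : NeZero μ := ⟨h0⟩
  simp only [laverage, average]
  set P := (μ univ)⁻¹ • μ with hP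
  have hPp : IsProbabilityMeasure P := isProbabilityMeasureSMul
  have hu' : Integrable u P := hu.smul_measure (by simp [h0])
  have h1 : ENNReal.ofReal |(∫ z, u z ∂P) - c| ≤ ∫⁻ y, ENNReal.ofReal |u y - c| ∂P := by
    have : (∫ z, u z ∂P) - c = ∫ z, (u z - c) ∂P := by
      rw [integral_sub hu' (integrable_const c)]
      simp
    rw [this, ← Real.enorm_eq_ofReal_abs]
    refine (enorm_integral_le_lintegral_enorm _).trans_eq ?_
    simp only [Real.enorm_eq_ofReal_abs]
  calc ∫⁻ y, ENNReal.ofReal |u y - ∫ z, u z ∂P| ∂P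
      ≤ ∫⁻ y, (ENNReal.ofReal |u y - c| + ENNReal.ofReal |(∫ z, u z ∂P) - c|) ∂P := by
        refine lintegral_mono fun y => ?_
        rw [← ENNReal.ofReal_add (abs_nonneg _) (abs_nonneg _)]
        refine ENNReal.ofReal_le_ofReal ?_
        rw [abs_sub_comm (∫ z, u z ∂P) c]
        exact abs_sub_le _ _ _
    _ = (∫⁻ y, ENNReal.ofReal |u y - c| ∂P) + ENNReal.ofReal |(∫ z, u z ∂P) - c| := by
        rw [lintegral_add_right _ measurable_const]
        simp
    _ ≤ _ := by rw [two_mul]; gcongr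

theorem setLAverage_le_of_subset {μ : Measure α} {s t : Set α} {K : ℝ≥0∞} (hst : s ⊆ t)
    (hs : μ s ≠ 0) (ht : μ t ≠ ∞) (hK : μ t ≤ K * μ s) (g : α → ℝ≥0∞) :
    ⨍⁻ y in s, g y ∂μ ≤ K * ⨍⁻ y in t, g y ∂μ := by
  have hle := measure_mono (μ := μ) hst
  rw [setLAverage_eq, setLAverage_eq]
  refine ennreal_div_le_mul_div hs (hle.trans_lt ht.lt_top).ne
    (fun h => hs (measure_mono_null hst h)) ht ?_
  calc _ ≤ (∫⁻ y in t, g y ∂μ) * (K * μ s) := by gcongr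
    _ = _ := by ring

theorem laverage_rpow_le {μ : Measure α} [IsFiniteMeasure μ] [NeZero μ] {g : α → ℝ≥0∞}
    (hg : Measurable g) {p q : ℝ} (hp : 0 < p) (hpq : p ≤ q) :
    (⨍⁻ y, g y ^ p ∂μ) ^ (1 / p) ≤ (⨍⁻ y, g y ^ q ∂μ) ^ (1 / q) := by
  have : IsProbabilityMeasure ((μ univ)⁻¹ • μ) := isProbabilityMeasureSMul
  simpa [eLpNorm', laverage] using
    eLpNorm'_le_eLpNorm'_of_exponent_le hp hpq ((μ univ)⁻¹ • μ) hg.aestronglyMeasurable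

end Average

/-! ### The constants of a Poincaré inequality -/

section Poincare

variable {X : Type} [MetricSpace X]

/-- A Poincaré inequality in which the factor `A` in front and the dilation `Λ` of the ball are
different gives one with a common constant, for a larger exponent `q`. Indeed, passing from `Λ` to
`2 ^ k * Λ` costs at most a factor `D ^ (k / q)`, with `D` the doubling constant, and for large `q`
this grows more slowly than `2 ^ k`. -/
theorem exists_poincareInequality_of_two_constants [MeasurableSpace X]
    [OpensMeasurableSpace X] {μ : Measure X}
    (hμ : IsDoublingMeasure μ) {p : ℝ} (hp : 1 ≤ p) {A Λ : ℝ} (hA : 0 < A) (hΛ : 0 < Λ)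
    (h : ∀ u : X → ℝ, (∃ K : ℝ≥0, LipschitzWith K u) → HasCompactSupport u →
      ∀ (x : X) (r : ℝ), 0 < r →
        ⨍⁻ y in Metric.ball x r, ENNReal.ofReal |u y - ⨍ z in Metric.ball x r, u z ∂μ| ∂μ ≤
          ENNReal.ofReal (A * Metric.diam (Metric.ball x r)) *
            (⨍⁻ y in Metric.ball x (Λ * r), pointLip u y ^ p ∂μ) ^ (1 / p)) :
    ∃ q : ℝ, 1 ≤ q ∧ PoincareInequality q μ := by
  obtain ⟨D, -, hD⟩ := hμ.exists_pow_bound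
  obtain ⟨m, hm⟩ := pow_unbounded_of_one_lt D (show (1 : ℝ≥0) < 3 / 2 by
    rw [← NNReal.coe_lt_coe]; norm_num)
  obtain ⟨k, hk⟩ := pow_unbounded_of_one_lt (A / Λ) (show (1 : ℝ) < 4 / 3 by norm_num)
  set q : ℝ := max p m with hq
  have hpq : p ≤ q := le_max_left _ _
  have hq0 : 0 < q := by linarith
  have hDq : (D : ℝ≥0∞) ≤ ((3 / 2 : ℝ≥0) : ℝ≥0∞) ^ q := by
    rw [← ENNReal.coe_rpow_of_nonneg _ hq0.le, ENNReal.coe_le_coe]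
    refine hm.le.trans ?_
    rw [← NNReal.rpow_natCast]
    refine NNReal.rpow_le_rpow_of_exponent_le ?_ (le_max_right _ _)
    rw [← NNReal.coe_le_coe]; norm_num
  have hcost : ((D : ℝ≥0∞) ^ k) ^ (1 / q) ≤ ENNReal.ofReal ((3 / 2) ^ k) := by
    calc ((D : ℝ≥0∞) ^ k) ^ (1 / q) ≤ ((((3 / 2 : ℝ≥0) : ℝ≥0∞) ^ q) ^ k) ^ (1 / q) := by
          gcongr
      _ = ((3 / 2 : ℝ≥0) : ℝ≥0∞) ^ k := by
          rw [← ENNReal.rpow_natCast, ← ENNReal.rpow_mul, ← ENNReal.rpow_mul,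
            ← ENNReal.rpow_natCast]
          congr 1
          field_simp
      _ = ENNReal.ofReal ((3 / 2) ^ k) := by
          rw [ENNReal.ofReal_pow (by norm_num)]
          congr 1
          rw [← ENNReal.ofReal_coe_nnreal]
          norm_num
  have hconst : A * (3 / 2) ^ k ≤ 2 ^ k * Λ := by
    rw [div_lt_iff₀ hΛ] at hk
    calc A * (3 / 2) ^ k ≤ ((4 / 3) ^ k * Λ) * (3 / 2) ^ k := by gcongr
      _ = ((4 / 3) * (3 / 2)) ^ k * Λ := by rw [mul_pow]; ring
      _ = 2 ^ k * Λ := by norm_num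
  refine ⟨q, hp.trans hpq, 2 ^ k * Λ, by positivity, fun u hu hu' x r hr => ?_⟩
  have hmeas : Measurable (pointLip u) := by
    obtain ⟨K, hK⟩ := hu
    exact measurable_pointLip hK.continuous
  have hr' : 0 < Λ * r := by positivity
  have hfin : IsFiniteMeasure (μ.restrict (Metric.ball x (Λ * r))) :=
    ⟨by simpa using (hμ.ball_ne_top x (Λ * r)).lt_top⟩
  have hne : NeZero (μ.restrict (Metric.ball x (Λ * r))) :=
    ⟨by rw [Ne, Measure.restrict_eq_zero]; exact hμ.ball_pos x hr'⟩
  have h1 : (⨍⁻ y in Metric.ball x (Λ * r), pointLip u y ^ p ∂μ) ^ (1 / p) ≤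
      ENNReal.ofReal ((3 / 2) ^ k) *
        (⨍⁻ y in Metric.ball x (2 ^ k * Λ * r), pointLip u y ^ q ∂μ) ^ (1 / q) := by
    refine (laverage_rpow_le hmeas (by linarith) hpq).trans ?_
    refine (ENNReal.rpow_le_rpow (setLAverage_le_of_subset
      (t := Metric.ball x (2 ^ k * Λ * r)) (K := (D : ℝ≥0∞) ^ k) ?_
      (hμ.ball_pos x hr') (hμ.ball_ne_top x _) ?_ _) (by positivity)).trans ?_
    · refine Metric.ball_subset_ball ?_
      rw [mul_assoc]
      exact le_mul_of_one_le_left hr'.le (one_le_pow₀ one_le_two)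
    · rw [mul_assoc]
      exact hD k x _ hr'
    · rw [ENNReal.mul_rpow_of_nonneg _ _ (by positivity)]
      gcongr
  calc _ ≤ _ := h u hu hu' x r hr
    _ ≤ _ := mul_le_mul_right h1 _
    _ ≤ _ := by
      rw [← mul_assoc, ← ENNReal.ofReal_mul (mul_nonneg hA.le Metric.diam_nonneg)]
      refine mul_le_mul_left (ENNReal.ofReal_le_ofReal ?_) _
      rw [mul_right_comm]
      exact mul_le_mul_of_nonneg_right hconst Metric.diam_nonneg

end Poincare

/-! ### Symmetric quotients of PI spaces -/

theorem IsDoublingMeasure.exists_fibre_net {X Y : Type} [MetricSpace X] [MeasurableSpace X]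
    [OpensMeasurableSpace X] [CompactSpace X] {μ : Measure X} (hμ : IsDoublingMeasure μ)
    (f : X → Y) (x : X) {r : ℝ} (hr : 0 < r) :
    ∃ F : Finset X, (∀ n ∈ F, f n = f x) ∧ (F : Set X).Pairwise (fun x y => r ≤ dist x y) ∧
      ∀ z, f z = f x → ∃ n ∈ F, dist z n < r := by
  obtain ⟨N, hN⟩ := hμ.exists_card_bound isCompact_univ.isBounded hr
  exact exists_maximal_separated {z | f z = f x} hr hN

/-- An `L`-Lipschitz map `f` between metric spaces such that every point `y` of the target lifts to
a point over `y` at the same distance from a given `x` as `y` has from `f x`, and such that the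
isometries of the source that preserve the measure `μ` and the map `f` act transitively on every
fibre. -/
structure IsSymmetricQuotient {X Y : Type} [MetricSpace X] [MeasurableSpace X] [MetricSpace Y]
    (μ : Measure X) (f : X → Y) (L : ℝ≥0) : Prop where
  one_le : 1 ≤ L
  lipschitz : LipschitzWith L f
  exists_lift : ∀ x y, ∃ x', f x' = y ∧ dist x x' = dist (f x) y
  exists_symm : ∀ x x', f x = f x' →
    ∃ e : X ≃ᵢ X, e x = x' ∧ (∀ z, f (e z) = f z) ∧ MeasurePreserving e μ μ

namespace IsSymmetricQuotient

section Fibre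

variable {X Y : Type} [MetricSpace X] [MeasurableSpace X] [MetricSpace Y]
  {μ : Measure X} {f : X → Y} {L : ℝ≥0}

theorem surjective [Nonempty X] (hf : IsSymmetricQuotient μ f L) : Function.Surjective f := by
  intro y
  obtain ⟨x⟩ := ‹Nonempty X›
  obtain ⟨x', h, -⟩ := hf.exists_lift x y
  exact ⟨x', h⟩

theorem preimage_ball_subset (hf : IsSymmetricQuotient μ f L) {r s : ℝ} {x : X} {F : Finset X}
    (hF : ∀ z, f z = f x → ∃ n ∈ F, dist z n < r) :
    f ⁻¹' Metric.ball (f x) s ⊆ ⋃ n ∈ F, Metric.ball n (r + s) := by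
  intro z hz
  obtain ⟨z', hz', hd⟩ := hf.exists_lift z (f x)
  obtain ⟨n, hn, hzn⟩ := hF z' hz'
  refine mem_iUnion₂.2 ⟨n, hn, ?_⟩
  have hz : dist (f z) (f x) < s := hz
  have := dist_triangle z z' n
  rw [Metric.mem_ball]
  linarith

theorem ball_subset_preimage (hf : IsSymmetricQuotient μ f L) {x n : X} (hn : f n = f x) (r : ℝ) :
    Metric.ball n r ⊆ f ⁻¹' Metric.ball (f x) (L * r) := by
  intro z hz
  have hL : (0 : ℝ) < L := by exact_mod_cast zero_lt_one.trans_le hf.one_le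
  rw [mem_preimage, ← hn]
  exact (hf.lipschitz.dist_le_mul z n).trans_lt (by gcongr; exact hz)

theorem isLipschitzQuotient (hf : IsSymmetricQuotient μ f L) : IsLipschitzQuotient f := by
  have hL : (1 : ℝ) ≤ L := by exact_mod_cast hf.one_le
  refine ⟨L, by positivity, fun x r hr => ⟨fun y hy => ?_,
    image_subset_iff.2 (hf.ball_subset_preimage rfl r)⟩⟩
  obtain ⟨x', rfl, hd⟩ := hf.exists_lift x y
  refine ⟨x', ?_, rfl⟩
  rw [Metric.mem_ball, dist_comm, hd, dist_comm]
  exact (Metric.mem_ball.1 hy).trans_le (mul_le_of_le_one_left hr.le (inv_le_one_of_one_le₀ hL))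

theorem isometryEquiv_comp {Z : Type} [MetricSpace Z] (hf : IsSymmetricQuotient μ f L)
    (e : Y ≃ᵢ Z) : IsSymmetricQuotient μ (e ∘ f) L where
  one_le := hf.one_le
  lipschitz := by simpa using e.isometry.lipschitz.comp hf.lipschitz
  exists_lift x z := by
    obtain ⟨x', h, hd⟩ := hf.exists_lift x (e.symm z)
    refine ⟨x', by simp [h], ?_⟩
    rw [hd, Function.comp_apply, ← e.dist_eq, e.apply_symm_apply]
  exists_symm x x' h := by
    obtain ⟨g, hg, hgf, hμ⟩ := hf.exists_symm x x' (e.injective h)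
    exact ⟨g, hg, fun z => congrArg e (hgf z), hμ⟩

variable [BorelSpace X]

/-- Functions that factor through `f` have the same integral over balls of the same radius centred
at points of the same fibre. -/
theorem setLIntegral_ball_eq (hf : IsSymmetricQuotient μ f L) {x x' : X} (h : f x = f x') (r : ℝ)
    (g : Y → ℝ≥0∞) :
    ∫⁻ z in Metric.ball x r, g (f z) ∂μ = ∫⁻ z in Metric.ball x' r, g (f z) ∂μ := by
  obtain ⟨e, rfl, he, hμ⟩ := hf.exists_symm x x' h
  have hemb : MeasurableEmbedding e := e.toHomeomorph.measurableEmbedding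
  rw [← hμ.setLIntegral_comp_preimage_emb hemb _ (Metric.ball (e x) r)]
  simp only [he, e.preimage_ball, e.symm_apply_apply]

theorem measure_ball_eq (hf : IsSymmetricQuotient μ f L) {x x' : X} (h : f x = f x') (r : ℝ) :
    μ (Metric.ball x r) = μ (Metric.ball x' r) := by
  simpa using hf.setLIntegral_ball_eq h r fun _ => 1

variable [MeasurableSpace Y] [BorelSpace Y]

theorem measurable (hf : IsSymmetricQuotient μ f L) : Measurable f :=
  hf.lipschitz.continuous.measurable

theorem setLIntegral_map_ball (hf : IsSymmetricQuotient μ f L) {g : Y → ℝ≥0∞}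
    (hg : Measurable g) (y : Y) (r : ℝ) :
    ∫⁻ z in Metric.ball y r, g z ∂(μ.map f) =
      ∫⁻ z in f ⁻¹' Metric.ball y r, g (f z) ∂μ :=
  setLIntegral_map Metric.isOpen_ball.measurableSet hg hf.measurable

theorem map_ball (hf : IsSymmetricQuotient μ f L) (y : Y) (r : ℝ) :
    μ.map f (Metric.ball y r) = μ (f ⁻¹' Metric.ball y r) :=
  Measure.map_apply hf.measurable Metric.isOpen_ball.measurableSet

/-- The preimage of a ball of radius `s` is covered by the balls of radius `r + s` around the points
of an `r`-dense subset of the fibre, and all of these contribute equally. -/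
theorem setLIntegral_map_ball_le (hf : IsSymmetricQuotient μ f L) {r s : ℝ} {x : X} {F : Finset X}
    (hFx : ∀ n ∈ F, f n = f x) (hF : ∀ z, f z = f x → ∃ n ∈ F, dist z n < r)
    {g : Y → ℝ≥0∞} (hg : Measurable g) :
    ∫⁻ z in Metric.ball (f x) s, g z ∂(μ.map f) ≤
      F.card * ∫⁻ z in Metric.ball x (r + s), g (f z) ∂μ := by
  rw [hf.setLIntegral_map_ball hg]
  calc ∫⁻ z in f ⁻¹' Metric.ball (f x) s, g (f z) ∂μ
      ≤ ∫⁻ z in ⋃ n : F, Metric.ball (n : X) (r + s), g (f z) ∂μ := by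
        refine lintegral_mono_set ((hf.preimage_ball_subset hF).trans_eq ?_)
        rw [iUnion_subtype]
    _ ≤ ∑' n : F, ∫⁻ z in Metric.ball (n : X) (r + s), g (f z) ∂μ := lintegral_iUnion_le _ _
    _ = ∑ n ∈ F, ∫⁻ z in Metric.ball n (r + s), g (f z) ∂μ :=
        F.tsum_subtype fun n => ∫⁻ z in Metric.ball n (r + s), g (f z) ∂μ
    _ = ∑ n ∈ F, ∫⁻ z in Metric.ball x (r + s), g (f z) ∂μ :=
        Finset.sum_congr rfl fun n hn => hf.setLIntegral_ball_eq (hFx n hn) _ g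
    _ = _ := by simp

theorem map_ball_le (hf : IsSymmetricQuotient μ f L) {r s : ℝ} {x : X} {F : Finset X}
    (hFx : ∀ n ∈ F, f n = f x) (hF : ∀ z, f z = f x → ∃ n ∈ F, dist z n < r) :
    μ.map f (Metric.ball (f x) s) ≤ F.card * μ (Metric.ball x (r + s)) := by
  simpa using hf.setLIntegral_map_ball_le hFx hF (s := s) (measurable_const (a := (1 : ℝ≥0∞)))

/-- Small balls around the points of an `r`-separated subset of a fibre are disjoint, have the same
measure and project into the ball of radius `r`. -/
theorem card_mul_measure_ball_le (hf : IsSymmetricQuotient μ f L) {r s : ℝ} (hr : 0 < r)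
    (hs : s ≤ r / (2 * L)) {x : X} {F : Finset X} (hFx : ∀ n ∈ F, f n = f x)
    (hF : (F : Set X).Pairwise fun x y => r ≤ dist x y) :
    F.card * μ (Metric.ball x s) ≤ μ.map f (Metric.ball (f x) r) := by
  have hL : (1 : ℝ) ≤ L := by exact_mod_cast hf.one_le
  rw [le_div_iff₀ (by positivity)] at hs
  rw [hf.map_ball]
  calc F.card * μ (Metric.ball x s) = ∑ n ∈ F, μ (Metric.ball n s) := by
        rw [Finset.sum_congr rfl fun n hn => hf.measure_ball_eq (hFx n hn) s]
        simp
    _ ≤ _ := sum_measure_ball_le μ hF (by nlinarith) fun n hn =>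
        (hf.ball_subset_preimage (hFx n hn) s).trans
          (preimage_mono (Metric.ball_subset_ball (by nlinarith)))

/-- The balls of radius `r` around the points of an `r`-separated subset of a fibre have bounded
overlap. -/
theorem exists_card_mul_setLIntegral_le (hf : IsSymmetricQuotient μ f L)
    (hμ : IsDoublingMeasure μ) :
    ∃ K : ℝ≥0, ∀ (x : X) (r : ℝ), 0 < r → ∀ F : Finset X, (∀ n ∈ F, f n = f x) →
      (F : Set X).Pairwise (fun x y => r ≤ dist x y) → ∀ g : Y → ℝ≥0∞, Measurable g →
      F.card * ∫⁻ z in Metric.ball x r, g (f z) ∂μ ≤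
        K * ∫⁻ z in Metric.ball (f x) (L * r), g z ∂(μ.map f) := by
  classical
  obtain ⟨K, hK⟩ := hμ.exists_bound 5
  refine ⟨K, fun x r hr F hFx hF g hg => ?_⟩
  have hcount : ∀ z : X, ((F.filter fun n => z ∈ Metric.ball n r).card : ℝ≥0∞) ≤ K := by
    intro z
    rcases (F.filter fun n => z ∈ Metric.ball n r).eq_empty_or_nonempty with he | ⟨n₀, hn₀⟩
    · rw [he]
      simp
    obtain ⟨hn₀F, hn₀⟩ := Finset.mem_filter.1 hn₀
    have hpos := hμ.ball_pos x (half_pos hr)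
    refine (ENNReal.mul_le_mul_iff_left hpos (hμ.ball_ne_top x _)).1 ?_
    calc ((F.filter fun n => z ∈ Metric.ball n r).card : ℝ≥0∞) * μ (Metric.ball x (r / 2))
        = ∑ n ∈ F.filter fun n => z ∈ Metric.ball n r, μ (Metric.ball n (r / 2)) := by
          rw [Finset.sum_congr rfl fun n hn =>
            hf.measure_ball_eq (hFx n (Finset.mem_filter.1 hn).1) _]
          simp
      _ ≤ μ (Metric.ball n₀ (5 * (r / 2))) := by
          refine sum_measure_ball_le μ (hF.mono fun n hn => ?_) le_rfl fun n hn => ?_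
          · exact (Finset.mem_filter.1 (Finset.mem_coe.1 hn)).1
          · have h1 : dist z n < r := (Finset.mem_filter.1 hn).2
            have h2 : dist z n₀ < r := hn₀
            refine Metric.ball_subset_ball' ?_
            have := dist_triangle_left n n₀ z
            linarith
      _ = μ (Metric.ball x (5 * (r / 2))) := hf.measure_ball_eq (hFx n₀ hn₀F) _
      _ ≤ K * μ (Metric.ball x (r / 2)) := hK x _ _ (half_pos hr) le_rfl
  have hgf : Measurable fun z => g (f z) := hg.comp hf.measurable
  rw [hf.setLIntegral_map_ball hg,
    ← lintegral_indicator (hf.measurable Metric.isOpen_ball.measurableSet),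
    ← lintegral_const_mul' _ _ ENNReal.coe_ne_top]
  calc F.card * ∫⁻ z in Metric.ball x r, g (f z) ∂μ
      = ∑ n ∈ F, ∫⁻ z in Metric.ball n r, g (f z) ∂μ := by
        rw [Finset.sum_congr rfl fun n hn => hf.setLIntegral_ball_eq (hFx n hn) r g]
        simp
    _ = ∫⁻ z, ∑ n ∈ F, (Metric.ball n r).indicator (fun z => g (f z)) z ∂μ := by
        rw [lintegral_finsetSum _ fun n _ => hgf.indicator Metric.isOpen_ball.measurableSet]
        refine Finset.sum_congr rfl fun n _ => ?_
        rw [lintegral_indicator Metric.isOpen_ball.measurableSet]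
    _ ≤ _ := by
        refine lintegral_mono fun z => ?_
        by_cases hz : z ∈ f ⁻¹' Metric.ball (f x) (L * r)
        · rw [indicator_of_mem hz]
          simp only [indicator_apply, ← Finset.sum_filter, Finset.sum_const, nsmul_eq_mul]
          exact mul_le_mul_left (hcount z) _
        · rw [Finset.sum_eq_zero]
          · exact zero_le
          · intro n hn
            exact indicator_of_notMem (fun h => hz (hf.ball_subset_preimage (hFx n hn) r h)) _

end Fibre

section PI

variable {X Y : Type} [MetricSpace X] [MeasurableSpace X] [CompactSpace X] [MetricSpace Y]
  {μ : Measure X} {f : X → Y} {L : ℝ≥0}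

/-- The Poincaré inequality involves diameters of balls, not radii. In a connected space the
diameter of a ball is at least its radius unless the ball is the whole space, and then the ratio of
the diameters of `X` and `Y` gives the bound. -/
theorem exists_diam_ball_le [Nonempty X] [ConnectedSpace Y] [Nontrivial Y]
    (hf : IsSymmetricQuotient μ f L) :
    ∃ K : ℝ, 0 < K ∧ ∀ (x : X) (r : ℝ), 0 < r →
      Metric.diam (Metric.ball x (2 * r)) ≤ K * Metric.diam (Metric.ball (f x) r) := by
  have hsurj := hf.surjective
  have hcont := hf.lipschitz.continuous
  have : CompactSpace Y := hsurj.compactSpace hcont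
  have hbY : Bornology.IsBounded (univ : Set Y) := isCompact_univ.isBounded
  have hdY : 0 < Metric.diam (univ : Set Y) := Metric.diam_pos nontrivial_univ hbY
  have hbX : Bornology.IsBounded (univ : Set X) := isCompact_univ.isBounded
  refine ⟨4 + Metric.diam (univ : Set X) / Metric.diam (univ : Set Y),
    add_pos_of_pos_of_nonneg four_pos (div_nonneg Metric.diam_nonneg Metric.diam_nonneg),
    fun x r hr => ?_⟩
  rw [add_mul]
  by_cases h : Metric.ball (f x) r = univ
  · rw [h, div_mul_cancel₀ _ hdY.ne']
    have := Metric.diam_mono (subset_univ (Metric.ball x (2 * r))) hbX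
    linarith
  · obtain ⟨y, hy⟩ := (ne_univ_iff_exists_notMem _).1 h
    rw [Metric.mem_ball, not_lt] at hy
    have hr : r ≤ Metric.diam (Metric.ball (f x) r) := by
      refine le_of_forall_lt_imp_le_of_dense fun s hs => ?_
      rcases lt_or_ge s 0 with h0 | h0
      · exact h0.le.trans Metric.diam_nonneg
      -- by connectedness the distance from `f x` takes the value `s`
      obtain ⟨z, hz⟩ := intermediate_value_univ (f x) y
        (continuous_id.dist (continuous_const (y := f x)))
        (show s ∈ Icc (dist (f x) (f x)) (dist y (f x)) by
          rw [dist_self]; exact ⟨h0, hs.le.trans hy⟩)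
      have hz : dist z (f x) = s := hz
      rw [← hz]
      exact Metric.dist_le_diam_of_mem Metric.isBounded_ball
        (Metric.mem_ball.2 (hz.trans_lt hs)) (Metric.mem_ball_self ‹_›)
    have h1 : Metric.diam (Metric.ball x (2 * r)) ≤ 2 * (2 * r) := Metric.diam_ball (by positivity)
    have h2 : 0 ≤ Metric.diam (univ : Set X) / Metric.diam (univ : Set Y) *
      Metric.diam (Metric.ball (f x) r) := by positivity
    linarith

variable [BorelSpace X] [MeasurableSpace Y] [BorelSpace Y]

theorem isDoublingMeasure_map [Nonempty X] (hf : IsSymmetricQuotient μ f L)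
    (hμ : IsDoublingMeasure μ) : IsDoublingMeasure (μ.map f) := by
  have hL : (1 : ℝ) ≤ L := by exact_mod_cast hf.one_le
  obtain ⟨K, hK⟩ := hμ.exists_bound (3 * (2 * L))
  refine ⟨K, fun y r hr => ?_⟩
  obtain ⟨x, rfl⟩ := hf.surjective y
  refine ⟨?_, ?_, ?_⟩
  · refine (hμ.ball_pos x (r := r / L) (by positivity)).bot_lt.trans_le ?_
    rw [hf.map_ball]
    refine measure_mono ((hf.ball_subset_preimage rfl _).trans_eq ?_)
    rw [mul_div_cancel₀ _ (by positivity)]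
  · rw [hf.map_ball]
    exact (measure_mono (subset_univ _)).trans_lt
      (hμ.measure_univ_ne_top isCompact_univ.isBounded).lt_top
  · obtain ⟨F, hFx, hF, hc⟩ := hμ.exists_fibre_net f x hr
    calc μ.map f (Metric.ball (f x) (2 * r)) ≤ F.card * μ (Metric.ball x (r + 2 * r)) :=
          hf.map_ball_le hFx hc
      _ ≤ F.card * (K * μ (Metric.ball x (r / (2 * L)))) := by
          gcongr
          refine hK x _ _ (by positivity) (le_of_eq ?_)
          field_simp
          ring
      _ = K * (F.card * μ (Metric.ball x (r / (2 * L)))) := by ring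
      _ ≤ _ := by
          gcongr
          exact hf.card_mul_measure_ball_le hr le_rfl hFx hF

/-- An average over a ball of the quotient is controlled by the average of the lifted function over
one ball: covering the preimage and packing disjoint balls into it involve the same number of
points of the fibre. -/
theorem exists_setLAverage_map_le [Nonempty X] (hf : IsSymmetricQuotient μ f L)
    (hμ : IsDoublingMeasure μ) :
    ∃ K : ℝ≥0, ∀ (x : X) (r : ℝ), 0 < r → ∀ g : Y → ℝ≥0∞, Measurable g →
      ⨍⁻ z in Metric.ball (f x) r, g z ∂(μ.map f) ≤
        K * ⨍⁻ z in Metric.ball x (2 * r), g (f z) ∂μ := by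
  have hL : (1 : ℝ) ≤ L := by exact_mod_cast hf.one_le
  obtain ⟨K, hK⟩ := hμ.exists_bound (2 * (2 * L))
  refine ⟨K, fun x r hr g hg => ?_⟩
  have hν := hf.isDoublingMeasure_map hμ
  obtain ⟨F, hFx, hF, hc⟩ := hμ.exists_fibre_net f x hr
  rw [setLAverage_eq, setLAverage_eq]
  refine ennreal_div_le_mul_div (hν.ball_pos _ hr) (hν.ball_ne_top _ _)
    (hμ.ball_pos _ (by positivity)) (hμ.ball_ne_top _ _) ?_
  calc _ ≤ (F.card * ∫⁻ z in Metric.ball x (r + r), g (f z) ∂μ) *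
          (K * μ (Metric.ball x (r / (2 * L)))) := by
        gcongr
        · exact hf.setLIntegral_map_ball_le hFx hc hg
        · refine hK x _ _ (by positivity) (le_of_eq ?_)
          field_simp
    _ = K * ((∫⁻ z in Metric.ball x (2 * r), g (f z) ∂μ) *
          (F.card * μ (Metric.ball x (r / (2 * L))))) := by rw [← two_mul]; ring
    _ ≤ _ := by
        gcongr
        exact hf.card_mul_measure_ball_le hr le_rfl hFx hF

/-- The converse comparison, by bounded overlap of the balls around a net of the fibre. -/
theorem exists_setLAverage_comp_le [Nonempty X] (hf : IsSymmetricQuotient μ f L)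
    (hμ : IsDoublingMeasure μ) :
    ∃ K : ℝ≥0, ∀ (x : X) (r : ℝ), 0 < r → ∀ g : Y → ℝ≥0∞, Measurable g →
      ⨍⁻ z in Metric.ball x r, g (f z) ∂μ ≤
        K * ⨍⁻ z in Metric.ball (f x) (L * r), g z ∂(μ.map f) := by
  have hL : (1 : ℝ) ≤ L := by exact_mod_cast hf.one_le
  obtain ⟨K₁, hK₁⟩ := hf.exists_card_mul_setLIntegral_le hμ
  obtain ⟨K₂, hK₂⟩ := hμ.exists_bound (1 + L)
  refine ⟨K₂ * K₁, fun x r hr g hg => ?_⟩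
  have hν := hf.isDoublingMeasure_map hμ
  obtain ⟨F, hFx, hF, hc⟩ := hμ.exists_fibre_net f x hr
  rw [setLAverage_eq, setLAverage_eq]
  refine ennreal_div_le_mul_div (hμ.ball_pos _ hr) (hμ.ball_ne_top _ _)
    (hν.ball_pos _ (by positivity)) (hν.ball_ne_top _ _) ?_
  calc _ ≤ (∫⁻ z in Metric.ball x r, g (f z) ∂μ) * (F.card * (K₂ * μ (Metric.ball x r))) := by
        gcongr
        refine (hf.map_ball_le hFx hc).trans ?_
        gcongr
        exact hK₂ x _ _ hr (le_of_eq (by ring))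
    _ = K₂ * ((F.card * ∫⁻ z in Metric.ball x r, g (f z) ∂μ) * μ (Metric.ball x r)) := by ring
    _ ≤ K₂ * ((K₁ * ∫⁻ z in Metric.ball (f x) (L * r), g z ∂(μ.map f)) *
          μ (Metric.ball x r)) := by
        have := hK₁ x r hr F hFx hF g hg
        gcongr
    _ = _ := by push_cast; ring

/-- A connected nontrivial symmetric quotient of a compact PI space is a PI space. A function `u` on
the quotient lifts to a function with the same average over all balls of a given radius centred at
points of a given fibre. This common average can replace the average of `u` in the Poincaré
inequality, so that no two of these balls need to be connected by chains. -/
theorem isPISpace_map [Nonempty X] [ConnectedSpace Y] [Nontrivial Y]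
    (hf : IsSymmetricQuotient μ f L) {p : ℝ} (hX : IsPPISpace p μ) : IsPISpace (μ.map f) := by
  have hμ := hX.doubling
  have hp := hX.one_le
  have hL : (1 : ℝ) ≤ L := by exact_mod_cast hf.one_le
  have hcont := hf.lipschitz.continuous
  have hν := hf.isDoublingMeasure_map hμ
  have : CompactSpace Y := hf.surjective.compactSpace hcont
  have hfin : IsFiniteMeasure (μ.map f) :=
    ⟨(hν.measure_univ_ne_top isCompact_univ.isBounded).lt_top⟩
  obtain ⟨C, hC, hP⟩ := hX.poincare
  obtain ⟨K₁, hK₁⟩ := hf.exists_setLAverage_map_le hμ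
  obtain ⟨K₂, hK₂⟩ := hf.exists_setLAverage_comp_le hμ
  obtain ⟨K₃, hK₃, hdiam⟩ := hf.exists_diam_ball_le
  -- `B` collects the factors lost by the oscillation, by the two comparisons of averages and by the
  -- pointwise Lipschitz constant of the lift; below, `B + 1` replaces it, as `B` could vanish
  set B : ℝ≥0 := 2 * K₁ * (L * K₂ ^ (1 / p)) with hB
  have htwo := exists_poincareInequality_of_two_constants hν hp (A := (B + 1) * C * K₃)
    (Λ := L * (C * 2)) (by positivity) (by positivity) fun u hu hu' y r hr => by
    obtain ⟨x, rfl⟩ := hf.surjective y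
    obtain ⟨K, hK⟩ := hu
    have hmeas : Measurable (pointLip u) := measurable_pointLip hK.continuous
    have hint : Integrable u (μ.map f) := by
      simpa using hK.continuous.continuousOn.integrableOn_compact isCompact_univ
    have hP' := hP (u ∘ f) ⟨K * L, hK.comp hf.lipschitz⟩
      (HasCompactSupport.of_compactSpace _) x (2 * r) (by positivity)
    set c := ⨍ z in Metric.ball x (2 * r), (u ∘ f) z ∂μ
    have hlip : (⨍⁻ z in Metric.ball x (C * (2 * r)), pointLip (u ∘ f) z ^ p ∂μ) ^ (1 / p) ≤
        (L * K₂ ^ (1 / p) : ℝ≥0) *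
        (⨍⁻ z in Metric.ball (f x) (L * (C * 2) * r), pointLip u z ^ p ∂(μ.map f)) ^ (1 / p) := by
      calc _ ≤ (⨍⁻ z in Metric.ball x (C * (2 * r)),
              (fun y => (L : ℝ≥0∞) ^ p * pointLip u y ^ p) (f z) ∂μ) ^ (1 / p) := by
            refine ENNReal.rpow_le_rpow (laverage_mono_ae (Eventually.of_forall fun z => ?_))
              (by positivity)
            beta_reduce
            rw [← ENNReal.mul_rpow_of_nonneg _ _ (by positivity)]
            have := pointLip_comp_le (zero_lt_one.trans_le hf.one_le).ne' hf.lipschitz u z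
            gcongr
        _ ≤ (K₂ * ⨍⁻ z in Metric.ball (f x) (L * (C * (2 * r))),
              (L : ℝ≥0∞) ^ p * pointLip u z ^ p ∂(μ.map f)) ^ (1 / p) := by
            refine ENNReal.rpow_le_rpow (hK₂ x _ (by positivity) _ ?_) (by positivity)
            exact (hmeas.pow_const p).const_mul _
        _ = _ := by
            have hr' : (L : ℝ) * (C * (2 * r)) = L * (C * 2) * r := by ring
            rw [laverage, lintegral_const_mul _ (hmeas.pow_const p), ← laverage, hr',
              ENNReal.mul_rpow_of_nonneg _ _ (by positivity),
              ENNReal.mul_rpow_of_nonneg _ _ (by positivity), ← ENNReal.rpow_mul,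
              mul_one_div_cancel (by positivity), ENNReal.rpow_one, ENNReal.coe_mul,
              ENNReal.coe_rpow_of_nonneg _ (by positivity)]
            ring
    calc _ ≤ 2 * ⨍⁻ z in Metric.ball (f x) r, ENNReal.ofReal |u z - c| ∂(μ.map f) :=
          laverage_sub_average_le hint.integrableOn c
      _ ≤ 2 * (K₁ * ⨍⁻ z in Metric.ball x (2 * r), ENNReal.ofReal |u (f z) - c| ∂μ) := by
          gcongr
          refine hK₁ x r hr (fun z => ENNReal.ofReal |u z - c|) ?_
          exact ENNReal.measurable_ofReal.comp
            (hK.continuous.sub continuous_const).abs.measurable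
      _ ≤ 2 * (K₁ * (ENNReal.ofReal (C * Metric.diam (Metric.ball x (2 * r))) *
            ((L * K₂ ^ (1 / p) : ℝ≥0) *
        (⨍⁻ z in Metric.ball (f x) (L * (C * 2) * r),
          pointLip u z ^ p ∂(μ.map f)) ^ (1 / p)))) := by
          gcongr
          exact hP'.trans (mul_le_mul_right hlip _)
      _ = ENNReal.ofReal (B * (C * Metric.diam (Metric.ball x (2 * r)))) *
        (⨍⁻ z in Metric.ball (f x) (L * (C * 2) * r),
          pointLip u z ^ p ∂(μ.map f)) ^ (1 / p) := by
          rw [ENNReal.ofReal_mul (p := (B : ℝ)) B.2, ENNReal.ofReal_coe_nnreal, hB]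
          push_cast
          ring
      _ ≤ _ := by
          refine mul_le_mul_left (ENNReal.ofReal_le_ofReal ?_) _
          calc (B : ℝ) * (C * Metric.diam (Metric.ball x (2 * r)))
              ≤ (B + 1) * (C * (K₃ * Metric.diam (Metric.ball (f x) r))) := by
                gcongr
                · exact le_add_of_nonneg_right zero_le_one
                · exact hdiam x r hr
            _ = _ := by ring
  obtain ⟨q, hq, hPq⟩ := htwo
  exact ⟨q, hq, inferInstance, inferInstance, hν, hPq⟩

end PI

end IsSymmetricQuotient

/-! ### The square -/

theorem isCompact_square : IsCompact {a : EuclideanSpace ℝ (Fin 2) | ∀ i, a i ∈ Icc (0 : ℝ) 1} := by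
  have h : IsCompact (WithLp.toLp 2 '' univ.pi fun _ : Fin 2 => Icc (0 : ℝ) 1) :=
    (isCompact_univ_pi fun _ => isCompact_Icc).image (PiLp.continuous_toLp 2 _)
  convert h using 1
  ext a
  constructor
  · exact fun ha => ⟨a.ofLp, fun i _ => ha i, rfl⟩
  · rintro ⟨b, hb, rfl⟩ i
    exact hb i (mem_univ i)

theorem compactSpace_square : CompactSpace Square :=
  isCompact_iff_compactSpace.1 isCompact_square

theorem connectedSpace_square : ConnectedSpace Square := by
  refine isConnected_iff_connectedSpace.1 ⟨⟨0, fun i => by simp⟩, Convex.isPreconnected ?_⟩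
  intro a ha b hb s t hs ht hst i
  exact convex_Icc (0 : ℝ) 1 (ha i) (hb i) hs ht hst

theorem nontrivial_square : Nontrivial Square := by
  refine ⟨⟨0, fun i => by simp⟩, ⟨WithLp.toLp 2 fun _ => 1, fun i => by simp⟩, fun h => ?_⟩
  have := congrArg (fun a : Square => a.1 0) h
  simp at this

/-! ### Sheets and symmetries -/

theorem symmetry_sheetMap (w v : ℕ → ZMod 2) (a : Square) :
    symmetry w (sheetMap v a) = sheetMap (v + w) a := rfl

theorem add_add_cancel_word (v w : ℕ → ZMod 2) : v + w + w = v := by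
  ext i
  simp [add_assoc, CharTwo.add_self_eq_zero]

theorem symmetry_symmetry (w : ℕ → ZMod 2) (x : Pillow) : symmetry w (symmetry w x) = x := by
  obtain ⟨v, hv⟩ := exists_sheet x
  rw [← hv, symmetry_sheetMap, symmetry_sheetMap, add_add_cancel_word]

theorem proj_symmetry (w : ℕ → ZMod 2) (x : Pillow) : proj (symmetry w x) = proj x :=
  piMap_flipX1 _ _

theorem exists_symmetry_eq {x y : Pillow} (h : proj x = proj y) : ∃ w, symmetry w x = y := by
  obtain ⟨v, hv⟩ := exists_sheet x
  obtain ⟨w, hw⟩ := exists_sheet y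
  refine ⟨w + v, ?_⟩
  rw [← hv, ← hw, symmetry_sheetMap, h, ← add_assoc, add_comm v w, add_add_cancel_word]

theorem sheetMap_injective (w : ℕ → ZMod 2) : Function.Injective (sheetMap w) := fun a b h => by
  simpa only [proj_sheetMap] using congrArg proj h

theorem dist_proj_le_pillowDist (x y : Pillow) : dist (proj x) (proj y) ≤ pillowDist x y := by
  refine le_trans ?_ (le_ciSup (bddAbove_stageDist x y) 0)
  obtain ⟨l, hl⟩ := exists_chain x y
  exact le_csInf ⟨l, hl 0⟩ fun m hm => hm.dist_le

/-- Sheets are isometric to the Euclidean square in the geodesic metric of the pillow space. -/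
theorem pillowDist_sheetMap (w : ℕ → ZMod 2) (a b : Square) :
    pillowDist (sheetMap w a) (sheetMap w b) = dist a b :=
  le_antisymm (ciSup_le fun n => stageDist_le (chain_sheet n w a b))
    (dist_proj_le_pillowDist (sheetMap w a) (sheetMap w b))

/-! ### The metric induced on the square -/

/-- The metric on the square for which the sheet of the zero word is isometrically embedded in the
pillow space with the metric `d`. For symmetric `d` the choice of the sheet does not matter. -/
@[reducible] noncomputable def sheetMetric (d : MetricSpace Pillow) : MetricSpace Square :=
  MetricSpace.induced (sheetMap 0) (sheetMap_injective 0) d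

section Symmetric

variable {d : MetricSpace Pillow}

theorem IsSymmetricMetric.dist_sheetMap (hd : IsSymmetricMetric d) (w : ℕ → ZMod 2)
    (a b : Square) :
    dist (toMetric d (sheetMap w a)) (toMetric d (sheetMap w b)) =
      dist (toMetric (sheetMetric d) a) (toMetric (sheetMetric d) b) := by
  have h := hd w (sheetMap 0 a) (sheetMap 0 b)
  rw [symmetry_sheetMap, symmetry_sheetMap, zero_add] at h
  exact h

/-- The symmetry of a word as an isometry of a symmetric metric. -/
def IsSymmetricMetric.isometryEquiv (hd : IsSymmetricMetric d) (w : ℕ → ZMod 2) :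
    WithMetric Pillow d ≃ᵢ WithMetric Pillow d where
  toFun x := toMetric d (symmetry w (ofMetric d x))
  invFun x := toMetric d (symmetry w (ofMetric d x))
  left_inv := symmetry_symmetry w
  right_inv := symmetry_symmetry w
  isometry_toFun := Isometry.of_dist_eq fun x y => hd w x y

/-- A sheet with a symmetric metric is isometric to the square with the induced metric. -/
noncomputable def IsSymmetricMetric.sheetIsometryEquiv (hd : IsSymmetricMetric d)
    (w : ℕ → ZMod 2) :
    WithMetric Square (sheetMetric d) ≃ᵢ (ofMetric d ⁻¹' sheet w : Set (WithMetric Pillow d)) :=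
  IsometryEquiv.mk (Equiv.ofInjective (sheetMap w) (sheetMap_injective w))
    (Isometry.of_dist_eq fun a b => hd.dist_sheetMap w a b)

/-- Since `sheetMap 0` is isometric from the Euclidean square and from the induced metric to the
pillow space with the metrics `pillowMetric` and `d`, quasisymmetry restricts to the sheet. -/
theorem quasisymmetricByIdentity_sheetMetric (hqs : QuasisymmetricByIdentity pillowMetric d) :
    QuasisymmetricByIdentity squareMetric (sheetMetric d) := by
  obtain ⟨hhom, η, hη⟩ := hqs
  have : CompactSpace (WithMetric Square squareMetric) := compactSpace_square
  let s : WithMetric Square squareMetric → WithMetric Pillow pillowMetric := sheetMap 0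
  have hs : Isometry s := Isometry.of_dist_eq fun a b => pillowDist_sheetMap 0 a b
  let t : WithMetric Square (sheetMetric d) → WithMetric Pillow d := sheetMap 0
  have ht : Isometry t := Isometry.of_dist_eq fun a b => rfl
  refine ⟨isHomeomorph_iff_continuous_bijective.2 ⟨?_, Function.bijective_id⟩, η,
    fun x y z hxz => ?_⟩
  · exact ht.isEmbedding.continuous_iff.2 (hhom.continuous.comp hs.continuous)
  · rw [← hs.nndist_eq, ← hs.nndist_eq]
    exact hη (s x) (s y) (s z) (hs.injective.ne hxz)

/-- The lift `z` of `proj y` to a sheet through `x` satisfies `d₀(x, z) ≤ d₀(x, y)`, which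
quasisymmetry turns into a bound of `d(x, z)`, the distance of the projections, by `d(x, y)`. -/
theorem IsSymmetricMetric.exists_lipschitzWith_projFrom (hd : IsSymmetricMetric d)
    (hqs : QuasisymmetricByIdentity pillowMetric d) :
    ∃ L : ℝ≥0, 1 ≤ L ∧ LipschitzWith L (projFrom d (sheetMetric d)) := by
  obtain ⟨-, η, hη⟩ := hqs
  obtain ⟨M, hM⟩ := (isCompact_Icc (a := (0 : ℝ≥0)) (b := 1)).bddAbove_image
    η.continuous.continuousOn
  refine ⟨max 1 M, le_max_left _ _, LipschitzWith.of_dist_le_mul fun x y => ?_⟩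
  rcases eq_or_ne x y with rfl | hxy
  · simp
  obtain ⟨w, hw⟩ := exists_sheet x
  set z : Pillow := sheetMap w (proj y) with hz
  have hxz : dist (toMetric d x) (toMetric d z) =
      dist (projFrom d (sheetMetric d) x) (projFrom d (sheetMetric d) y) := by
    have h := hd.dist_sheetMap w (proj x) (proj y)
    rw [hw] at h
    exact h
  have hle : nndist (toMetric pillowMetric x) (toMetric pillowMetric z) ≤
      nndist (toMetric pillowMetric x) (toMetric pillowMetric y) := by
    rw [← NNReal.coe_le_coe, coe_nndist, coe_nndist]
    have h := pillowDist_sheetMap w (proj x) (proj y)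
    rw [hw] at h
    exact h.trans_le (dist_proj_le_pillowDist x y)
  have hq := (hη x z y hxy).trans
    (hM (mem_image_of_mem η ⟨zero_le, div_le_one_of_le₀ hle zero_le⟩))
  have hpos : 0 < nndist (toMetric d x) (toMetric d y) := dist_pos.2 hxy
  have hq' := (div_le_iff₀ hpos).1 hq
  rw [← hxz]
  calc dist (toMetric d x) (toMetric d z)
      ≤ M * dist (toMetric d x) (toMetric d y) := by exact_mod_cast hq'
    _ ≤ _ := by
      gcongr
      · exact le_max_right _ _
      · exact le_rfl

/-- The projection to the square with the induced metric is a symmetric quotient. -/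
theorem IsSymmetricMetric.exists_isSymmetricQuotient (hd : IsSymmetricMetric d)
    (hqs : QuasisymmetricByIdentity pillowMetric d) (Q : ℝ) :
    ∃ L : ℝ≥0, IsSymmetricQuotient
      (Measure.hausdorffMeasure Q : Measure (WithMetric Pillow d))
      (projFrom d (sheetMetric d)) L := by
  obtain ⟨L, hL, hlip⟩ := hd.exists_lipschitzWith_projFrom hqs
  refine ⟨L, hL, hlip, fun x y => ?_, fun x x' h => ?_⟩
  · obtain ⟨w, hw⟩ := exists_sheet x
    refine ⟨sheetMap w y, rfl, ?_⟩
    have h := hd.dist_sheetMap w (proj x) y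
    rw [hw] at h
    exact h
  · obtain ⟨w, hw⟩ := exists_symmetry_eq (x := x) (y := x') h
    exact ⟨hd.isometryEquiv w, hw, fun z => proj_symmetry w z,
      (hd.isometryEquiv w).measurePreserving_hausdorffMeasure Q⟩

/-- The pillow space is bounded because all sheets are copies of one bounded space and meet at a
corner. -/
theorem IsSymmetricMetric.isBounded_univ (hd : IsSymmetricMetric d)
    (hb : Bornology.IsBounded (univ : Set (WithMetric Square (sheetMetric d)))) :
    Bornology.IsBounded (univ : Set (WithMetric Pillow d)) := by
  obtain ⟨R, hR⟩ := Metric.isBounded_iff.1 hb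
  refine (Metric.isBounded_iff_subset_closedBall
    (toMetric d (sheetMap 0 ⟨0, by simp⟩))).2 ⟨R, fun x _ => ?_⟩
  obtain ⟨w, hw⟩ := exists_sheet x
  have h := hd.dist_sheetMap w (proj x) ⟨0, by simp⟩
  rw [hw, sheetMap_corner w 0] at h
  exact h.trans_le (hR (mem_univ _) (mem_univ _))

end Symmetric

end PillowSpace

open PillowSpace
theorem mainTheorem6 (Q : ℝ) (d : MetricSpace Pillow)
    (hsymm : IsSymmetricMetric d)
    (hqs : QuasisymmetricByIdentity pillowMetric d)
    (hL : IsLoewner Q (WithMetric Pillow d)) :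
    (∃ ρ : MetricSpace Square,
      QuasisymmetricByIdentity squareMetric ρ ∧
      IsLipschitzQuotient (projFrom d ρ) ∧
      (∀ w : ℕ → ZMod 2, ∀ x ∈ sheet w, ∀ y ∈ sheet w,
        dist (toMetric ρ (proj x)) (toMetric ρ (proj y)) =
          dist (toMetric d x) (toMetric d y)) ∧
      IsPISpace (Measure.map (projFrom d ρ)
        (Measure.hausdorffMeasure Q : Measure (WithMetric Pillow d)))) ∧
    (∀ w : ℕ → ZMod 2,
      ∃ ν : Measure (ofMetric d ⁻¹' sheet w : Set (WithMetric Pillow d)), IsPISpace ν) := by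
  obtain ⟨L, hquot⟩ := hsymm.exists_isSymmetricQuotient hqs Q
  have hρ := quasisymmetricByIdentity_sheetMetric hqs
  have : CompactSpace (WithMetric Square squareMetric) := compactSpace_square
  have : ConnectedSpace (WithMetric Square squareMetric) := connectedSpace_square
  have : CompactSpace (WithMetric Square (sheetMetric d)) :=
    hρ.1.surjective.compactSpace hρ.1.continuous
  have : ConnectedSpace (WithMetric Square (sheetMetric d)) :=
    hρ.1.surjective.connectedSpace hρ.1.continuous
  have : Nontrivial (WithMetric Square (sheetMetric d)) := nontrivial_square
  have : CompleteSpace (WithMetric Pillow d) := hL.pi.complete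
  have : CompactSpace (WithMetric Pillow d) :=
    hL.pi.doubling.compactSpace (hsymm.isBounded_univ isCompact_univ.isBounded)
  have : Nonempty (WithMetric Pillow d) := ⟨sheetMap 0 ⟨0, by simp⟩⟩
  refine ⟨⟨sheetMetric d, hρ, hquot.isLipschitzQuotient, ?_, hquot.isPISpace_map hL.pi⟩,
    fun w => ?_⟩
  · rintro w _ ⟨a, rfl⟩ _ ⟨b, rfl⟩
    exact (hsymm.dist_sheetMap w a b).symm
  · let e := hsymm.sheetIsometryEquiv w
    have := e.surjective.connectedSpace e.continuous
    have := e.injective.nontrivial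
    exact ⟨_, (hquot.isometryEquiv_comp e).isPISpace_map hL.pi⟩
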